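/- Let $(M,J,g)$ be an almost skew-Hermitian manifold, i.e. $M$ is a smooth manifold, $J$ is a smooth almost complex structure on $M$ and $g$ is a smooth pseudo-Riemannian metric with $g(JX,JY)=-g(X,Y)$ (so $\dim M=2n$ and $g$ has signature $(n,n)$). Let $X^H,X^V$ denote the horizontal and vertical lifts to $TM$ of a vector field $X$ on $M$, the horizontal lift being taken with respect to the Levi-Civita connection of $g$. Let $H=(J_1,J_2,J_3)$ be the almost hypercomplex structure on $TM$ given by $$J_1X^H=X^V,\quad J_1X^V=-X^H,\qquad J_2X^H=(JX)^V,\quad J_2X^V=(JX)^H,\qquad J_3=J_1\circ J_2,$$ and let $\hat g$ be the Sasaki metric, $\hat g(X^H,Y^H)=\hat g(X^V,Y^V)=g(X,Y)$, $\hat g(X^H,Y^V)=0$, with Levi-Civita connection $\hat\nabla$. The metric $\hat g$ is Hermitian with respect to $J_1$ and skew-Hermitian with respect to $J_2$ and $J_3$; $(TM,H,\hat G)$ denotes the resulting almost hypercomplex pseudo-Hermitian manifold, where $\hat G$ consists of $\hat g$ and the forms $\hat g(J_\alpha\cdot,\cdot)$. Call $(TM,J_\alpha)$ complex if $J_\alpha$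 is an almost complex structure with vanishing Nijenhuis tensor $N_\alpha(X,Y)=[X,Y]+J_\alpha[X,J_\alpha Y]+J_\alpha[J_\alpha X,Y]-[J_\alpha X,J_\alpha Y]$, and call $(TM,H)$ hypercomplex if $N_1=N_2=N_3=0$. Let $F_\alpha(X,Y,Z)=\hat g((\hat\nabla_XJ_\alpha)Y,Z)$. Call $(TM,J_\alpha,\hat g)$ Kähler with respect to $J_\alpha$ if $F_\alpha=0$ (a pseudo-Kähler manifold for $\alpha=1$, a skew-Kähler manifold for $\alpha=2,3$), and call $(TM,H,\hat G)$ pseudo-hyper-Kähler if $F_1=F_2=F_3=0$. Then: 1. for each $\alpha\in\{1,2,3\}$, $(TM,J_\alpha,\hat g)$ is complex if and only if it is Kähler with respect to $J_\alpha$; 2. $(TM,H,\hat G)$ is hypercomplex if and only if it is pseudo-hyper-Kähler. -/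

import Mathlib

open scoped Manifold ContDiff

noncomputable section

namespace SasakiTM

/-! ### Tensor fields, pseudo-Riemannian metrics and the Levi-Civita connection -/

section General

variable {E : Type*} [NormedAddCommGroup E] [NormedSpace ℝ E]
  {H : Type*} [TopologicalSpace H] (I : ModelWithCorners ℝ E H)
  (M : Type*) [TopologicalSpace M] [ChartedSpace H M]

/-- Vector fields (no regularity built in). -/
abbrev VField := (x : M) → TangentSpace I x

/-- Fields of endomorphisms of the tangent spaces; linearity and smoothness are imposed by
`IsAlmostComplex`. -/
abbrev EndoField := (x : M) → TangentSpace I x → TangentSpace I x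

/-- Fields of real functions of two tangent vectors; bilinearity and smoothness are imposed by
`IsMetric`. -/
abbrev BilinField := (x : M) → TangentSpace I x → TangentSpace I x → ℝ

variable {I M} [IsManifold I ∞ M]

/-- The vector field `X` is smooth at the point `x`. -/
def SmoothFieldAt (X : VField I M) (x : M) : Prop :=
  ContMDiffAt I I.tangent ∞ (fun y => (⟨y, X y⟩ : TangentBundle I M)) x

/-- `g` is a (smooth) pseudo-Riemannian metric. -/
structure IsMetric (g : BilinField I M) : Prop where
  add_left : ∀ x v v' w, g x (v + v') w = g x v w + g x v' w
  smul_left : ∀ x (c : ℝ) v w, g x (c • v) w = c * g x v w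
  symm : ∀ x v w, g x v w = g x w v
  nondegenerate : ∀ x v, (∀ w, g x v w = 0) → v = 0
  smooth : ∀ (X Y : VField I M) (x : M), SmoothFieldAt X x → SmoothFieldAt Y x →
    ContMDiffAt I 𝓘(ℝ, ℝ) ∞ (fun y => g y (X y) (Y y)) x

/-- `J` is a (smooth) almost complex structure. -/
structure IsAlmostComplex (J : EndoField I M) : Prop where
  add : ∀ x v w, J x (v + w) = J x v + J x w
  smul : ∀ x (c : ℝ) v, J x (c • v) = c • J x v
  sq : ∀ x v, J x (J x v) = -v
  smooth : ∀ (X : VField I M) (x : M), SmoothFieldAt X x →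
    SmoothFieldAt (fun y => J y (X y)) x

/-- `J` acts as an isometry of `g`. -/
def IsHermitian (g : BilinField I M) (J : EndoField I M) : Prop :=
  ∀ x v w, g x (J x v) (J x w) = g x v w

/-- `J` acts as an anti-isometry of `g`. -/
def IsSkewHermitian (g : BilinField I M) (J : EndoField I M) : Prop :=
  ∀ x v w, g x (J x v) (J x w) = -g x v w

/-- The derivative of the function `f` at `x` in the direction `v`. -/
def dirDeriv (f : M → ℝ) (x : M) (v : TangentSpace I x) : ℝ :=
  mvfderiv I f x v

/-- The right-hand side of the Koszul formula for `2 g(∇_X Y, Z)`. -/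
def koszul (g : BilinField I M) (X Y Z : VField I M) (x : M) : ℝ :=
  dirDeriv (fun y => g y (Y y) (Z y)) x (X x)
    + dirDeriv (fun y => g y (X y) (Z y)) x (Y x)
    - dirDeriv (fun y => g y (X y) (Y y)) x (Z x)
    + g x (VectorField.mlieBracket I X Y x) (Z x)
    + g x (VectorField.mlieBracket I Z X x) (Y x)
    + g x (VectorField.mlieBracket I Z Y x) (X x)

/-- The Levi-Civita connection of `g`: for `Y` smooth at `x`, the vector `∇_v Y` at `x` is the
unique tangent vector `w` such that `2 g(w, Z) = koszul g X Y Z` at `x` for all vector fields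
`X`, `Z` smooth at `x` with `X x = v`. -/
def leviCivita (g : BilinField I M) (Y : VField I M) (x : M) (v : TangentSpace I x) :
    TangentSpace I x :=
  Classical.epsilon fun w : TangentSpace I x =>
    ∀ X Z : VField I M, SmoothFieldAt X x → SmoothFieldAt Z x → X x = v →
      2 * g x w (Z x) = koszul g X Y Z x

/-- The structural tensor `F(X, Y, Z) = g((∇_X J) Y, Z)`, where
`(∇_X J) Y = ∇_X (J Y) - J (∇_X Y)`. -/
def structuralTensor (g : BilinField I M) (J : EndoField I M) (X Y Z : VField I M) (x : M) : ℝ :=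
  g x (leviCivita g (fun y => J y (Y y)) x (X x) - J x (leviCivita g Y x (X x))) (Z x)

/-- `F = 0`, i.e. `J` is parallel with respect to the Levi-Civita connection of `g`. -/
def StructuralTensorVanishes (g : BilinField I M) (J : EndoField I M) : Prop :=
  ∀ (X Y Z : VField I M) (x : M), SmoothFieldAt X x → SmoothFieldAt Y x → SmoothFieldAt Z x →
    structuralTensor g J X Y Z x = 0

/-- The Nijenhuis tensor `N(X, Y) = [X, Y] + J[X, JY] + J[JX, Y] - [JX, JY]`. -/
def nijenhuis (J : EndoField I M) (X Y : VField I M) (x : M) : TangentSpace I x :=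
  VectorField.mlieBracket I X Y x
    + J x (VectorField.mlieBracket I X (fun y => J y (Y y)) x)
    + J x (VectorField.mlieBracket I (fun y => J y (X y)) Y x)
    - VectorField.mlieBracket I (fun y => J y (X y)) (fun y => J y (Y y)) x

/-- `J` is an integrable almost complex structure: its Nijenhuis tensor vanishes. -/
structure IsComplex (J : EndoField I M) : Prop where
  almostComplex : IsAlmostComplex J
  nijenhuis_eq_zero : ∀ (X Y : VField I M) (x : M), SmoothFieldAt X x → SmoothFieldAt Y x →
    nijenhuis J X Y x = 0

/-- Almost skew-Hermitian manifold (Norden or B-metric). Nondegeneracy and the anti-isometry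
`J` force neutral signature. -/
structure IsAlmostSkewHermitian (g : BilinField I M) (J : EndoField I M) : Prop where
  metric : IsMetric g
  almostComplex : IsAlmostComplex J
  skewHermitian : IsSkewHermitian g J

/-- (Pseudo-)Kähler manifold: almost Hermitian with `F = 0`. -/
structure IsKahler (g : BilinField I M) (J : EndoField I M) : Prop where
  metric : IsMetric g
  almostComplex : IsAlmostComplex J
  hermitian : IsHermitian g J
  parallel : StructuralTensorVanishes g J

/-- Skew-Kähler manifold: almost skew-Hermitian with `F = 0`. -/
structure IsSkewKahler (g : BilinField I M) (J : EndoField I M) : Prop where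
  almostSkewHermitian : IsAlmostSkewHermitian g J
  parallel : StructuralTensorVanishes g J

/-- Almost hypercomplex structure: three pairwise anticommuting almost complex structures with
`J₃ = J₁ ∘ J₂`. -/
structure IsAlmostHypercomplex (J₁ J₂ J₃ : EndoField I M) : Prop where
  almostComplex₁ : IsAlmostComplex J₁
  almostComplex₂ : IsAlmostComplex J₂
  almostComplex₃ : IsAlmostComplex J₃
  anticomm₁₂ : ∀ x v, J₁ x (J₂ x v) = -J₂ x (J₁ x v)
  anticomm₂₃ : ∀ x v, J₂ x (J₃ x v) = -J₃ x (J₂ x v)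
  anticomm₃₁ : ∀ x v, J₃ x (J₁ x v) = -J₁ x (J₃ x v)
  comp : ∀ x v, J₃ x v = J₁ x (J₂ x v)

/-- Hypercomplex structure: almost hypercomplex with all three structures integrable. -/
structure IsHypercomplex (J₁ J₂ J₃ : EndoField I M) : Prop where
  almostHypercomplex : IsAlmostHypercomplex J₁ J₂ J₃
  complex₁ : IsComplex J₁
  complex₂ : IsComplex J₂
  complex₃ : IsComplex J₃

/-- Almost hypercomplex pseudo-Hermitian manifold: `g` is Hermitian with respect to `J₁` and
skew-Hermitian with respect to `J₂`, `J₃`. The forms `g(J₁ ·, ·)`, `g(J₂ ·, ·)`, `g(J₃ ·, ·)`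
that complete `g` to the structure `G` are determined by these data. -/
structure IsAlmostHypercomplexPseudoHermitian (g : BilinField I M)
    (J₁ J₂ J₃ : EndoField I M) : Prop where
  metric : IsMetric g
  almostHypercomplex : IsAlmostHypercomplex J₁ J₂ J₃
  hermitian₁ : IsHermitian g J₁
  skewHermitian₂ : IsSkewHermitian g J₂
  skewHermitian₃ : IsSkewHermitian g J₃

/-- Pseudo-hyper-Kähler manifold: `F_α = 0` for `α = 1, 2, 3`. -/
structure IsPseudoHyperKahler (g : BilinField I M) (J₁ J₂ J₃ : EndoField I M) : Prop where
  almost : IsAlmostHypercomplexPseudoHermitian g J₁ J₂ J₃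
  parallel₁ : StructuralTensorVanishes g J₁
  parallel₂ : StructuralTensorVanishes g J₂
  parallel₃ : StructuralTensorVanishes g J₃

end General

/-! ### The tangent bundle

At `u ∈ T_p M` the type `TangentSpace I.tangent u` is `E × E`, by definition of the manifold
structure of `TangentBundle I M`: a tangent vector is given by its components `(dx, dy)` with
respect to the induced coordinates `(x, y)` of the preferred chart of `M` at `p`. -/

section TangentBundle

variable {E : Type*} [NormedAddCommGroup E] [NormedSpace ℝ E]
  {H : Type*} [TopologicalSpace H] {I : ModelWithCorners ℝ E H}
  {M : Type*} [TopologicalSpace M] [ChartedSpace H M] [IsManifold I ∞ M]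

/-- The tangent vector to `TM` at `u` with components `(ξ, η)` in the induced coordinates. -/
def ofComponents (u : TangentBundle I M) (ξ η : TangentSpace I u.proj) :
    TangentSpace I.tangent u :=
  ((ξ, η) : E × E)

/-- The `dx`-components of a tangent vector to `TM`. -/
def dx (u : TangentBundle I M) (A : TangentSpace I.tangent u) : TangentSpace I u.proj :=
  (show E × E from A).1

/-- The `dy`-components of a tangent vector to `TM`. -/
def dy (u : TangentBundle I M) (A : TangentSpace I.tangent u) : TangentSpace I u.proj :=
  (show E × E from A).2

/-- The expression `Γ^k_{ij} ξ^i η^j` at `p` in the preferred chart at `p`, i.e. `∇_ξ` of the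
vector field that is equal to `η` at `p` and has constant components in this chart. -/
def christoffel (g : BilinField I M) (p : M) (ξ η : TangentSpace I p) : TangentSpace I p :=
  leviCivita g (FiberBundle.extend E η) p ξ

/-- The vertical lift to `u` of a tangent vector at the base point, with components `(0, w)`. -/
def vLift (u : TangentBundle I M) (w : TangentSpace I u.proj) : TangentSpace I.tangent u :=
  ofComponents u 0 w

/-- The horizontal lift to `u = (x, y)` of a tangent vector `w` at the base point, with
components `(w^k, -y^i Γ^k_{ij} w^j)`. -/
def hLift (g : BilinField I M) (u : TangentBundle I M) (w : TangentSpace I u.proj) :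
    TangentSpace I.tangent u :=
  ofComponents u w (-christoffel g u.proj w u.2)

/-- The vector `h` in the decomposition `A = h^H + v^V`. -/
def hPart (u : TangentBundle I M) (A : TangentSpace I.tangent u) : TangentSpace I u.proj :=
  dx u A

/-- The vector `v` in the decomposition `A = h^H + v^V`. -/
def vPart (g : BilinField I M) (u : TangentBundle I M) (A : TangentSpace I.tangent u) :
    TangentSpace I u.proj :=
  dy u A + christoffel g u.proj (dx u A) u.2

theorem hLift_add_vLift (g : BilinField I M) (u : TangentBundle I M)
    (A : TangentSpace I.tangent u) :
    hLift g u (hPart u A) + vLift u (vPart g u A) = A := by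
  refine Prod.ext ?_ ?_
  · exact add_zero (dx u A)
  · exact neg_add_cancel_comm_assoc (christoffel g u.proj (dx u A) u.2) (dy u A)

/-- `J₁ : X^H ↦ X^V, X^V ↦ -X^H`. -/
def liftJ₁ (g : BilinField I M) : EndoField I.tangent (TangentBundle I M) :=
  fun u A => vLift u (hPart u A) - hLift g u (vPart g u A)

/-- `J₂ : X^H ↦ (JX)^V, X^V ↦ (JX)^H`. -/
def liftJ₂ (g : BilinField I M) (J : EndoField I M) :
    EndoField I.tangent (TangentBundle I M) :=
  fun u A => vLift u (J u.proj (hPart u A)) + hLift g u (J u.proj (vPart g u A))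

/-- `J₃ = J₁ ∘ J₂`. -/
def liftJ₃ (g : BilinField I M) (J : EndoField I M) :
    EndoField I.tangent (TangentBundle I M) :=
  fun u A => liftJ₁ g u (liftJ₂ g J u A)

/-- The Sasaki metric: `ĝ(X^H, Y^H) = ĝ(X^V, Y^V) = g(X, Y)` and `ĝ(X^H, Y^V) = 0`. -/
def sasaki (g : BilinField I M) : BilinField I.tangent (TangentBundle I M) :=
  fun u A B => g u.proj (hPart u A) (hPart u B) + g u.proj (vPart g u A) (vPart g u B)

end TangentBundle

end SasakiTM

end

open scoped Manifold ContDiff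

noncomputable section

set_option maxSynthPendingDepth 3

namespace SasakiTM

open Set Filter Topology VectorField

/-! ### Vectors, vector fields, brackets and derivatives in a fixed chart -/

section Charts

variable {E : Type*} [NormedAddCommGroup E] [NormedSpace ℝ E]
  {H : Type*} [TopologicalSpace H] {I : ModelWithCorners ℝ E H}
  {M : Type*} [TopologicalSpace M] [ChartedSpace H M]

variable {x₀ x : M}

/-! Split every tangent vector of `TM` into its horizontal and vertical parts, each a vector of `M`.
On such pairs let `D` be the connection obtained by applying the Levi-Civita connection `∇` of `g`
to each part (`hvDeriv`). The Sasaki metric is `g ⊕ g` in this splitting, so `D` preserves it, and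
the torsion of `D` comes only from the curvature `R` of `g`: at the vector `y`, the bracket is `D_P
Q - D_Q P - (0, R(P_h, Q_h) y)` (`hvAt_mlieBracket`). Hence `D` is the Levi-Civita connection of the
Sasaki metric at every point over which `R = 0` (`hvAt_leviCivita_sasaki`).

Each `J_α` acts on the pairs by a field of endomorphisms `K` that depends on the base point only
(`ActsByOn`). The derivative `D K` vanishes for `α = 1` and is built from `S = ∇J` for `α = 2, 3`.
So `F_α = 0` follows from `R = 0` and, for `α = 2, 3`, `S = 0`.

Kähler implies complex for any metric: brackets are differences of covariant derivatives, and these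
commute with a parallel structure (`isComplex_of_parallel`).

For complex implies Kähler, the Nijenhuis tensor is evaluated on fields with constant components in
the splitting; it becomes an algebraic expression in `S` and `R` (`IsComplex.hv_nijenhuis_eq_zero`),
where the point `y` of the fibre is arbitrary. For `α = 1, 2` a pair of horizontal vectors gives `R
= 0` at once. For `α = 2` horizontal and vertical pairs together, and for `α = 3` a mixed pair, give
`S (J a) = -J ∘ S a`. Here `J` is self-adjoint for `g`, and `S a` is self-adjoint and anticommutes
with `J`, so `-J ∘ S a` is skew-adjoint while `S (J a)` is self-adjoint: both vanish
(`eq_zero_of_selfAdjoint_of_anticomm`).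

For `α = 3` horizontal pairs give only `-R(a,b) + J R(a,Jb) + J R(Ja,b) + R(Ja,Jb) = 0`. But `∇J =
0` makes `R` commute with `J`, and with the symmetries of `R` this gives `R(Ja,b) = R(a,Jb) = J
R(a,b)`; the identity then reads `-4 R = 0` (`curvature_eq_zero_of_pure`). -/

theorem symm_extChartAt (hx : x ∈ (chartAt H x₀).source) :
    (extChartAt I x₀).symm (extChartAt I x₀ x) = x :=
  (extChartAt I x₀).left_inv (by rwa [extChartAt_source])

theorem mem_chart_source_of_target {z : E} (hz : z ∈ (extChartAt I x₀).target) :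
    (extChartAt I x₀).symm z ∈ (chartAt H x₀).source := by
  rw [← extChartAt_source (I := I)]
  exact (extChartAt I x₀).map_target hz

theorem extChartAt_mem_target (hx : x ∈ (chartAt H x₀).source) :
    extChartAt I x₀ x ∈ (extChartAt I x₀).target :=
  (extChartAt I x₀).map_source (by rwa [extChartAt_source])

theorem extChartAt_target_mem_nhds_of_source [I.Boundaryless] (hx : x ∈ (chartAt H x₀).source) :
    (extChartAt I x₀).target ∈ 𝓝 (extChartAt I x₀ x) :=
  (isOpen_extChartAt_target x₀).mem_nhds (extChartAt_mem_target hx)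

variable [IsManifold I ∞ M]

variable (I) in
/-- The components of a tangent vector at `x` in the preferred chart at `x₀`. -/
def toModel (x₀ x : M) : TangentSpace I x →L[ℝ] E :=
  (trivializationAt E (TangentSpace I) x₀).continuousLinearMapAt ℝ x

variable (I) in
/-- The tangent vector at `x` with given components in the preferred chart at `x₀`. -/
def ofModel (x₀ x : M) : E →L[ℝ] TangentSpace I x :=
  (trivializationAt E (TangentSpace I) x₀).symmL ℝ x

/-- The components of a vector field in the preferred chart at `x₀`. -/
def fieldRep (x₀ : M) (X : VField I M) (z : E) : E :=
  toModel I x₀ ((extChartAt I x₀).symm z) (X ((extChartAt I x₀).symm z))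

variable (I) in
/-- The vector field with given components in the preferred chart at `x₀`. -/
def fieldOfRep (x₀ : M) (A : E → E) : VField I M :=
  fun x => ofModel I x₀ x (A (extChartAt I x₀ x))

theorem ofModel_toModel (hx : x ∈ (chartAt H x₀).source) (v : TangentSpace I x) :
    ofModel I x₀ x (toModel I x₀ x v) = v :=
  (trivializationAt E (TangentSpace I) x₀).symmL_continuousLinearMapAt hx v

theorem toModel_ofModel (hx : x ∈ (chartAt H x₀).source) (v : E) :
    toModel I x₀ x (ofModel I x₀ x v) = v :=
  (trivializationAt E (TangentSpace I) x₀).continuousLinearMapAt_symmL hx v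

theorem toModel_injective (hx : x ∈ (chartAt H x₀).source) :
    Function.Injective (toModel I x₀ x) :=
  Function.LeftInverse.injective (ofModel_toModel hx)

theorem toModel_self (x : M) (v : TangentSpace I x) : toModel I x x v = v := by
  rw [toModel, TangentBundle.continuousLinearMapAt_trivializationAt_eq_core (mem_chart_source H x)]
  exact (tangentBundleCore I M).coordChange_self (achart H x) x (mem_chart_source H x) v

theorem toModel_eq_tangentCoordChange (hx : x ∈ (chartAt H x₀).source) (v : TangentSpace I x) :
    toModel I x₀ x v = tangentCoordChange I x x₀ x v := by
  rw [toModel, TangentBundle.continuousLinearMapAt_trivializationAt_eq_core hx]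
  rfl

theorem fieldRep_extChartAt (hx : x ∈ (chartAt H x₀).source) (X : VField I M) :
    fieldRep x₀ X (extChartAt I x₀ x) = toModel I x₀ x (X x) := by
  rw [fieldRep, symm_extChartAt hx]

theorem fieldRep_fieldOfRep {z : E} (hz : z ∈ (extChartAt I x₀).target) (A : E → E) :
    fieldRep x₀ (fieldOfRep I x₀ A) z = A z := by
  rw [fieldRep, fieldOfRep, toModel_ofModel (mem_chart_source_of_target hz),
    (extChartAt I x₀).right_inv hz]

variable [I.Boundaryless]

theorem fieldRep_fieldOfRep_eventuallyEq (hx : x ∈ (chartAt H x₀).source) (A : E → E) :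
    fieldRep x₀ (fieldOfRep I x₀ A) =ᶠ[𝓝 (extChartAt I x₀ x)] A := by
  filter_upwards [extChartAt_target_mem_nhds_of_source hx] with z hz
  exact fieldRep_fieldOfRep hz A

theorem contMDiffAt_iff_contDiffAt_chart {F : Type*} [NormedAddCommGroup F] [NormedSpace ℝ F]
    (hx : x ∈ (chartAt H x₀).source) {f : M → F} :
    ContMDiffAt I 𝓘(ℝ, F) ∞ f x ↔
      ContDiffAt ℝ ∞ (f ∘ (extChartAt I x₀).symm) (extChartAt I x₀ x) := by
  rw [contMDiffAt_iff_source_of_mem_source hx, I.range_eq_univ, contMDiffWithinAt_univ,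
    contMDiffAt_iff_contDiffAt]

theorem smoothFieldAt_iff (hx : x ∈ (chartAt H x₀).source) {X : VField I M} :
    SmoothFieldAt X x ↔ ContDiffAt ℝ ∞ (fieldRep x₀ X) (extChartAt I x₀ x) := by
  have h := (trivializationAt E (TangentSpace I) x₀).contMDiffAt_section_iff (IB := I) (n := ∞)
    (s := X) (x₀ := x) hx
  refine h.trans ((contMDiffAt_iff_contDiffAt_chart hx).trans ?_)
  have e : (fun y => (trivializationAt E (TangentSpace I) x₀ ⟨y, X y⟩).2) ∘
      (extChartAt I x₀).symm =ᶠ[𝓝 (extChartAt I x₀ x)] fieldRep x₀ X := by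
    filter_upwards [extChartAt_target_mem_nhds_of_source hx] with z hz
    exact ((trivializationAt E (TangentSpace I) x₀).continuousLinearMapAt_apply_of_mem (R := ℝ)
      (mem_chart_source_of_target hz) _).symm
  exact ⟨fun h => h.congr_of_eventuallyEq e.symm, fun h => h.congr_of_eventuallyEq e⟩

theorem smoothFieldAt_fieldOfRep (hx : x ∈ (chartAt H x₀).source) {A : E → E}
    (hA : ContDiffAt ℝ ∞ A (extChartAt I x₀ x)) : SmoothFieldAt (fieldOfRep I x₀ A) x :=
  (smoothFieldAt_iff hx).2 (hA.congr_of_eventuallyEq (fieldRep_fieldOfRep_eventuallyEq hx A))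

theorem smoothFieldAt_fieldOfRep_const (hx : x ∈ (chartAt H x₀).source) (a : E) :
    SmoothFieldAt (fieldOfRep I x₀ fun _ => a) x :=
  smoothFieldAt_fieldOfRep hx contDiffAt_const

/-- Identities tested on smooth fields can thereby be tested on arbitrary tangent vectors, as
nondegeneracy of the metric requires. -/
theorem exists_smoothFieldAt (v : TangentSpace I x) :
    ∃ X : VField I M, SmoothFieldAt X x ∧ X x = v := by
  have hx := mem_chart_source H x
  refine ⟨fieldOfRep I x fun _ => toModel I x x v, smoothFieldAt_fieldOfRep_const hx _, ?_⟩
  rw [fieldOfRep, ofModel_toModel hx]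

theorem SmoothFieldAt.contDiffAt_fieldRep {X : VField I M} (hX : SmoothFieldAt X x)
    (hx : x ∈ (chartAt H x₀).source) : ContDiffAt ℝ ∞ (fieldRep x₀ X) (extChartAt I x₀ x) :=
  (smoothFieldAt_iff hx).1 hX

theorem SmoothFieldAt.differentiableAt_fieldRep {X : VField I M} (hX : SmoothFieldAt X x)
    (hx : x ∈ (chartAt H x₀).source) : DifferentiableAt ℝ (fieldRep x₀ X) (extChartAt I x₀ x) :=
  (hX.contDiffAt_fieldRep hx).differentiableAt (by simp)

theorem mfderiv_extChartAt_symm {z : E} (hz : z ∈ (extChartAt I x₀).target) :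
    mfderiv 𝓘(ℝ, E) I (extChartAt I x₀).symm z = ofModel I x₀ ((extChartAt I x₀).symm z) := by
  have := TangentBundle.symmL_trivializationAt (I := I) (mem_chart_source_of_target hz)
  rw [I.range_eq_univ, mfderivWithin_univ, (extChartAt I x₀).right_inv hz] at this
  exact this.symm

/-- Turns naturality of the Lie bracket under pullback into its coordinate formula. -/
theorem mpullback_extChartAt_symm {z : E} (hz : z ∈ (extChartAt I x₀).target) (X : VField I M) :
    mpullback 𝓘(ℝ, E) I (extChartAt I x₀).symm X z = fieldRep x₀ X z := by
  have hz' := mem_chart_source_of_target hz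
  rw [mpullback_apply, mfderiv_extChartAt_symm hz, fieldRep]
  have h : (ofModel I x₀ ((extChartAt I x₀).symm z)).inverse
      = toModel I x₀ ((extChartAt I x₀).symm z) := by
    apply ContinuousLinearMap.inverse_eq
    · ext v; exact ofModel_toModel hz' v
    · ext v; exact toModel_ofModel hz' v
  exact DFunLike.congr_fun h _

/-- The Lie bracket in a chart. -/
theorem toModel_mlieBracket [CompleteSpace E] (hx : x ∈ (chartAt H x₀).source) {X Y : VField I M}
    (hX : SmoothFieldAt X x) (hY : SmoothFieldAt Y x) :
    toModel I x₀ x (mlieBracket I X Y x) =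
      fderiv ℝ (fieldRep x₀ Y) (extChartAt I x₀ x) (toModel I x₀ x (X x))
        - fderiv ℝ (fieldRep x₀ X) (extChartAt I x₀ x) (toModel I x₀ x (Y x)) := by
  have hz := extChartAt_mem_target (I := I) hx
  have h2 : minSmoothness ℝ 2 ≤ ∞ := by
    rw [minSmoothness_of_isRCLikeNormedField]; exact WithTop.coe_le_coe.2 (le_top : (2 : ℕ∞) ≤ ⊤)
  have : IsManifold I (minSmoothness ℝ 2) M := IsManifold.of_le (n := ∞) h2
  have key := mpullback_mlieBracket (I := 𝓘(ℝ, E)) (I' := I) (f := (extChartAt I x₀).symm)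
    (V := X) (W := Y) (x₀ := extChartAt I x₀ x) (n := ∞)
    (by rw [symm_extChartAt hx]; exact hX.mdifferentiableAt (by simp))
    (by rw [symm_extChartAt hx]; exact hY.mdifferentiableAt (by simp))
    ((contMDiffOn_extChartAt_symm x₀).contMDiffAt (extChartAt_target_mem_nhds_of_source hx))
    h2
  rw [mpullback_extChartAt_symm hz, fieldRep_extChartAt hx] at key
  have e : ∀ X : VField I M, (mpullback 𝓘(ℝ, E) I (extChartAt I x₀).symm X : E → E)
      =ᶠ[𝓝 (extChartAt I x₀ x)] fieldRep x₀ X := fun X => by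
    filter_upwards [extChartAt_target_mem_nhds_of_source hx] with z hz
    exact mpullback_extChartAt_symm hz X
  have h3 : ∀ V W : E → E, mlieBracket 𝓘(ℝ, E) V W = lieBracket ℝ V W := fun V W =>
    (mlieBracketWithin_univ (I := 𝓘(ℝ, E)) (V := V) (W := W)).symm.trans
      (mlieBracketWithin_eq_lieBracketWithin.trans lieBracketWithin_univ)
  rw [key]
  refine (congrFun (h3 _ _) _).trans (((e X).lieBracket_vectorField_eq (e Y)).trans ?_)
  rw [lieBracket, fieldRep_extChartAt hx, fieldRep_extChartAt hx]

/-- Directional derivatives in a chart. -/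
theorem dirDeriv_eq_fderiv (hx : x ∈ (chartAt H x₀).source) {f : M → ℝ}
    (hf : ContMDiffAt I 𝓘(ℝ, ℝ) ∞ f x) (v : TangentSpace I x) :
    dirDeriv f x v =
      fderiv ℝ (f ∘ (extChartAt I x₀).symm) (extChartAt I x₀ x) (toModel I x₀ x v) := by
  have hz := extChartAt_mem_target (I := I) hx
  have h1 : MDifferentiableAt 𝓘(ℝ, E) I (extChartAt I x₀).symm (extChartAt I x₀ x) :=
    ((contMDiffOn_extChartAt_symm (n := ∞) x₀).contMDiffAt
      (extChartAt_target_mem_nhds_of_source hx)).mdifferentiableAt (by simp)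
  have h2 : MDifferentiableAt I 𝓘(ℝ, ℝ) f ((extChartAt I x₀).symm (extChartAt I x₀ x)) := by
    rw [symm_extChartAt hx]; exact hf.mdifferentiableAt (by simp)
  have h3 := mfderiv_comp (I'' := 𝓘(ℝ, ℝ)) (extChartAt I x₀ x) h2 h1
  rw [mfderiv_eq_fderiv, mfderiv_extChartAt_symm hz, symm_extChartAt hx] at h3
  rw [h3]
  change _ = mfderiv I 𝓘(ℝ, ℝ) f x (ofModel I x₀ x (toModel I x₀ x v))
  rw [ofModel_toModel hx]
  rfl

end Charts

/-! ### Christoffel symbols of a metric on an open set of a vector space -/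

section Model

variable {E : Type*} [NormedAddCommGroup E] [NormedSpace ℝ E]

theorem fderiv_apply_apply {F₁ F₂ F₃ : Type*} [NormedAddCommGroup F₁] [NormedSpace ℝ F₁]
    [NormedAddCommGroup F₂] [NormedSpace ℝ F₂] [NormedAddCommGroup F₃] [NormedSpace ℝ F₃]
    {G : E → F₁ →L[ℝ] F₂ →L[ℝ] F₃} {z : E}
    (hdiff : DifferentiableAt ℝ G z) (u : E) (v : F₁) (w : F₂) :
    fderiv ℝ (fun z' => G z' v w) z u = fderiv ℝ G z u v w := by
  rw [fderiv_clm_apply (hdiff.clm_apply (differentiableAt_const v)) (differentiableAt_const w),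
    fderiv_clm_apply hdiff (differentiableAt_const v)]
  simp

theorem fderiv_metric_symm {G : E → E →L[ℝ] E →L[ℝ] ℝ} {z : E}
    (hdiff : DifferentiableAt ℝ G z) (hsymm : ∀ᶠ z' in 𝓝 z, ∀ v w, G z' v w = G z' w v)
    (u v w : E) : fderiv ℝ G z u v w = fderiv ℝ G z u w v := by
  rw [← fderiv_apply_apply hdiff, ← fderiv_apply_apply hdiff]
  have : (fun z' => G z' v w) =ᶠ[𝓝 z] fun z' => G z' w v := by
    filter_upwards [hsymm] with z' hz'
    exact hz' v w
  rw [this.fderiv_eq]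

variable [FiniteDimensional ℝ E]

/-- A nondegenerate bilinear form on a finite-dimensional space is a duality. -/
theorem exists_equiv_of_nondegenerate (B : E →L[ℝ] E →L[ℝ] ℝ)
    (hB : ∀ v, (∀ w, B v w = 0) → v = 0) :
    ∃ e : E ≃L[ℝ] (E →L[ℝ] ℝ), (e : E →L[ℝ] (E →L[ℝ] ℝ)) = B := by
  have hinj : Function.Injective B.toLinearMap :=
    (injective_iff_map_eq_zero _).2 fun v hv => hB v fun w => by
      have : B v = 0 := hv
      rw [this]; rfl
  have hdim : Module.finrank ℝ E = Module.finrank ℝ (E →L[ℝ] ℝ) := by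
    rw [← LinearEquiv.finrank_eq (LinearMap.toContinuousLinearMap (𝕜 := ℝ) (E := E) (F' := ℝ))]
    exact (Subspace.dual_finrank_eq (K := ℝ) (V := E)).symm
  exact ⟨(LinearEquiv.ofInjectiveOfFinrankEq B.toLinearMap hinj hdim).toContinuousLinearEquiv,
    by ext; rfl⟩

/-- The Christoffel symbols (of the second kind) of a metric on a vector space, as a bilinear
map. -/
def modelChristoffel (G : E → E →L[ℝ] E →L[ℝ] ℝ) (z : E) : E →L[ℝ] E →L[ℝ] E :=
  (LinearMap.mk₂ ℝ (fun a b => (G z).inverse ((1 / 2 : ℝ) •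
      (fderiv ℝ G z a b + fderiv ℝ G z b a - ((fderiv ℝ G z).flip a).flip b)))
    (fun a a' b => by rw [← map_add]; congr 1; ext c; simp; ring)
    (fun r a b => by rw [← map_smul]; congr 1; ext c; simp; ring)
    (fun a b b' => by rw [← map_add]; congr 1; ext c; simp; ring)
    (fun r a b => by rw [← map_smul]; congr 1; ext c; simp; ring)).toContinuousBilinearMap

theorem modelChristoffel_apply (G : E → E →L[ℝ] E →L[ℝ] ℝ) (z a b : E) :
    modelChristoffel G z a b = (G z).inverse ((1 / 2 : ℝ) •
      (fderiv ℝ G z a b + fderiv ℝ G z b a - ((fderiv ℝ G z).flip a).flip b)) := rfl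

/-- Koszul formula for constant fields, whose brackets vanish. Nondegeneracy makes `(G z).inverse` a
true inverse. -/
theorem two_mul_metric_modelChristoffel {G : E → E →L[ℝ] E →L[ℝ] ℝ} {z : E}
    (hG : ∀ v, (∀ w, G z v w = 0) → v = 0) (a b c : E) :
    2 * G z (modelChristoffel G z a b) c =
      fderiv ℝ G z a b c + fderiv ℝ G z b a c - fderiv ℝ G z c a b := by
  obtain ⟨e, he⟩ := exists_equiv_of_nondegenerate (G z) hG
  have h : ∀ u, G z ((G z).inverse u) = u := fun u => by
    rw [← he, ContinuousLinearMap.inverse_equiv]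
    exact e.apply_symm_apply u
  rw [modelChristoffel_apply, h]
  simp

theorem modelChristoffel_symm {G : E → E →L[ℝ] E →L[ℝ] ℝ} {z : E}
    (hdiff : DifferentiableAt ℝ G z) (hsymm : ∀ᶠ z' in 𝓝 z, ∀ v w, G z' v w = G z' w v)
    (a b : E) : modelChristoffel G z a b = modelChristoffel G z b a := by
  have hd := fderiv_metric_symm hdiff hsymm
  rw [modelChristoffel_apply, modelChristoffel_apply]
  congr 2
  ext c
  simp [hd c b a, add_comm]

/-- Metric compatibility: in the sum of two Koszul formulas, with the last two arguments exchanged,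
all but one derivative cancels. -/
theorem fderiv_metric_eq {G : E → E →L[ℝ] E →L[ℝ] ℝ} {z : E}
    (hdiff : DifferentiableAt ℝ G z) (hsymm : ∀ᶠ z' in 𝓝 z, ∀ v w, G z' v w = G z' w v)
    (hG : ∀ v, (∀ w, G z v w = 0) → v = 0) (a b c : E) :
    fderiv ℝ G z a b c =
      G z (modelChristoffel G z a b) c + G z b (modelChristoffel G z a c) := by
  have h1 := two_mul_metric_modelChristoffel hG a b c
  have h2 := two_mul_metric_modelChristoffel hG a c b
  have hd := fderiv_metric_symm hdiff hsymm
  rw [hsymm.self_of_nhds b]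
  linarith [hd a b c, hd b a c, hd c a b]

/-- Inversion of operators is smooth near an invertible one, so `Γ` is as smooth as the first
derivative of the metric. -/
theorem contDiffOn_modelChristoffel {G : E → E →L[ℝ] E →L[ℝ] ℝ} {U : Set E} (hU : IsOpen U)
    (hdiff : ContDiffOn ℝ ∞ G U) (hG : ∀ z ∈ U, ∀ v, (∀ w, G z v w = 0) → v = 0) :
    ContDiffOn ℝ ∞ (modelChristoffel G) U := by
  have hcomp := FiniteDimensional.complete ℝ E
  have hD := hdiff.fderiv_of_isOpen (m := ∞) hU (by simp)
  have hinv : ContDiffOn ℝ ∞ (fun z => (G z).inverse) U := fun z hz => by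
    obtain ⟨e, he⟩ := exists_equiv_of_nondegenerate (G z) (hG z hz)
    have := contDiffAt_map_inverse (𝕜 := ℝ) (n := ∞) e
    rw [he] at this
    exact this.comp_contDiffWithinAt z (hdiff z hz)
  refine contDiffOn_clm_apply.2 fun a => contDiffOn_clm_apply.2 fun b => ?_
  refine hinv.clm_apply (ContDiffOn.const_smul _ (ContDiffOn.sub
    (ContDiffOn.add ((hD.clm_apply contDiffOn_const).clm_apply contDiffOn_const)
    ((hD.clm_apply contDiffOn_const).clm_apply contDiffOn_const)) ?_))
  refine contDiffOn_clm_apply.2 fun c => ?_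
  exact ((hD.clm_apply (contDiffOn_const (c := c))).clm_apply (contDiffOn_const (c := a))).clm_apply
    (contDiffOn_const (c := b))

end Model

/-! ### The Levi-Civita connection of `M` -/

section LeviCivita

variable {E : Type*} [NormedAddCommGroup E] [NormedSpace ℝ E]
  {H : Type*} [TopologicalSpace H] {I : ModelWithCorners ℝ E H}
  {M : Type*} [TopologicalSpace M] [ChartedSpace H M] [IsManifold I ∞ M]
  {g : BilinField I M} {J : EndoField I M}

theorem IsMetric.add_right (hg : IsMetric g) (x : M) (v w w' : TangentSpace I x) :
    g x v (w + w') = g x v w + g x v w' := by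
  rw [hg.symm, hg.add_left, hg.symm x w, hg.symm x w']

theorem IsMetric.smul_right (hg : IsMetric g) (x : M) (c : ℝ) (v w : TangentSpace I x) :
    g x v (c • w) = c * g x v w := by
  rw [hg.symm, hg.smul_left, hg.symm x w]

theorem IsMetric.neg_left (hg : IsMetric g) (x : M) (v w : TangentSpace I x) :
    g x (-v) w = -g x v w := by
  rw [← neg_one_smul ℝ v, hg.smul_left, neg_one_mul]

theorem IsMetric.neg_right (hg : IsMetric g) (x : M) (v w : TangentSpace I x) :
    g x v (-w) = -g x v w := by
  rw [hg.symm, hg.neg_left, hg.symm]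

theorem IsMetric.sub_left (hg : IsMetric g) (x : M) (v v' w : TangentSpace I x) :
    g x (v - v') w = g x v w - g x v' w := by
  rw [sub_eq_add_neg, hg.add_left, hg.neg_left, sub_eq_add_neg]

theorem IsMetric.zero_left (hg : IsMetric g) (x : M) (w : TangentSpace I x) : g x 0 w = 0 := by
  rw [← zero_smul ℝ (0 : TangentSpace I x), hg.smul_left, zero_mul]

theorem IsAlmostComplex.neg (hJ : IsAlmostComplex J) (x : M) (v : TangentSpace I x) :
    J x (-v) = -J x v := by
  rw [← neg_one_smul ℝ v, hJ.smul, neg_one_smul]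

theorem IsAlmostComplex.sub (hJ : IsAlmostComplex J) (x : M) (v w : TangentSpace I x) :
    J x (v - w) = J x v - J x w := by
  rw [sub_eq_add_neg, hJ.add, hJ.neg, sub_eq_add_neg]

section

variable {x : M} [I.Boundaryless]

/-- A torsion-free metric covariant derivative at `x` is given by the Levi-Civita connection. -/
theorem leviCivita_eq_of_torsionFree_of_metric (hg : IsMetric g)
    (D : VField I M → TangentSpace I x → TangentSpace I x)
    (htors : ∀ X Y, SmoothFieldAt X x → SmoothFieldAt Y x →
      D Y (X x) - D X (Y x) = mlieBracket I X Y x)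
    (hmet : ∀ Y Z, SmoothFieldAt Y x → SmoothFieldAt Z x → ∀ v,
      dirDeriv (fun y => g y (Y y) (Z y)) x v = g x (D Y v) (Z x) + g x (Y x) (D Z v))
    {Y : VField I M} (hY : SmoothFieldAt Y x) (v : TangentSpace I x) :
    leviCivita g Y x v = D Y v := by
  -- Existence: substituting metric compatibility and zero torsion into the Koszul expression leaves
  -- `2 g(D_X Y, Z)`.
  have hk : ∀ X Z : VField I M, SmoothFieldAt X x → SmoothFieldAt Z x → X x = v →
      2 * g x (D Y v) (Z x) = koszul g X Y Z x := by
    rintro X Z hX hZ rfl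
    rw [koszul, hmet _ _ hY hZ, hmet _ _ hX hZ, hmet _ _ hX hY, ← htors X Y hX hY,
      ← htors Z X hZ hX, ← htors Z Y hZ hY, hg.sub_left, hg.sub_left, hg.sub_left,
      hg.symm x (Y x) (D Z (X x)), hg.symm x (X x) (D Z (Y x)), hg.symm x (X x) (D Y (Z x))]
    ring
  have hs := Classical.epsilon_spec (p := fun w : TangentSpace I x =>
    ∀ X Z : VField I M, SmoothFieldAt X x → SmoothFieldAt Z x → X x = v →
      2 * g x w (Z x) = koszul g X Y Z x) ⟨_, hk⟩
  -- Uniqueness: two solutions of the Koszul identity have the same product with every `Z x`.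
  obtain ⟨X, hX, hXv⟩ := exists_smoothFieldAt v
  refine sub_eq_zero.1 (hg.nondegenerate x _ fun w => ?_)
  obtain ⟨Z, hZ, rfl⟩ := exists_smoothFieldAt w
  have h1 := hs X Z hX hZ hXv
  have h2 := hk X Z hX hZ hXv
  rw [hg.sub_left]
  change 2 * g x (leviCivita g Y x v) (Z x) = _ at h1
  linarith

theorem StructuralTensorVanishes.leviCivita_comm (hg : IsMetric g)
    (h : StructuralTensorVanishes g J) {X Y : VField I M}
    (hX : SmoothFieldAt X x) (hY : SmoothFieldAt Y x) :
    leviCivita g (fun y => J y (Y y)) x (X x) = J x (leviCivita g Y x (X x)) := by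
  refine sub_eq_zero.1 (hg.nondegenerate x _ fun w => ?_)
  obtain ⟨Z, hZ, rfl⟩ := exists_smoothFieldAt w
  exact h X Y Z x hX hY hZ

end

variable [FiniteDimensional ℝ E]

/-- The components of a metric in the preferred chart at `x₀`. -/
def metricRep (hg : IsMetric g) (x₀ : M) (z : E) : E →L[ℝ] E →L[ℝ] ℝ :=
  (LinearMap.mk₂ ℝ (fun a b => g ((extChartAt I x₀).symm z)
      (ofModel I x₀ _ a) (ofModel I x₀ _ b))
    (fun a a' b => by rw [map_add, hg.add_left])
    (fun r a b => by rw [map_smul, hg.smul_left, smul_eq_mul])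
    (fun a b b' => by rw [map_add, hg.add_right])
    (fun r a b => by rw [map_smul, hg.smul_right, smul_eq_mul])).toContinuousBilinearMap

theorem metricRep_apply (hg : IsMetric g) (x₀ : M) (z a b : E) :
    metricRep hg x₀ z a b = g ((extChartAt I x₀).symm z)
      (ofModel I x₀ _ a) (ofModel I x₀ _ b) := rfl

/-- The components of an almost complex structure in the preferred chart at `x₀`. -/
def endoRep (hJ : IsAlmostComplex J) (x₀ : M) (z : E) : E →L[ℝ] E :=
  LinearMap.toContinuousLinearMap
    { toFun := fun a => toModel I x₀ _ (J ((extChartAt I x₀).symm z) (ofModel I x₀ _ a))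
      map_add' := fun a b => by rw [map_add, hJ.add, map_add]
      map_smul' := fun r a => by rw [map_smul, hJ.smul, map_smul]; rfl }

theorem endoRep_apply (hJ : IsAlmostComplex J) (x₀ : M) (z a : E) :
    endoRep hJ x₀ z a =
      toModel I x₀ _ (J ((extChartAt I x₀).symm z) (ofModel I x₀ _ a)) := rfl

variable {x₀ x : M}

theorem metricRep_toModel (hg : IsMetric g) (hx : x ∈ (chartAt H x₀).source)
    (v w : TangentSpace I x) :
    metricRep hg x₀ (extChartAt I x₀ x) (toModel I x₀ x v) (toModel I x₀ x w) = g x v w := by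
  rw [metricRep_apply, symm_extChartAt hx, ofModel_toModel hx, ofModel_toModel hx]

theorem endoRep_toModel (hJ : IsAlmostComplex J) (hx : x ∈ (chartAt H x₀).source)
    (v : TangentSpace I x) :
    endoRep hJ x₀ (extChartAt I x₀ x) (toModel I x₀ x v) = toModel I x₀ x (J x v) := by
  rw [endoRep_apply, symm_extChartAt hx, ofModel_toModel hx]

theorem metricRep_fieldRep (hg : IsMetric g) {z : E} (hz : z ∈ (extChartAt I x₀).target)
    (X Y : VField I M) :
    metricRep hg x₀ z (fieldRep x₀ X z) (fieldRep x₀ Y z) =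
      g ((extChartAt I x₀).symm z) (X _) (Y _) := by
  rw [metricRep_apply, fieldRep, fieldRep, ofModel_toModel (mem_chart_source_of_target hz),
    ofModel_toModel (mem_chart_source_of_target hz)]

theorem metricRep_symm (hg : IsMetric g) (x₀ : M) (z a b : E) :
    metricRep hg x₀ z a b = metricRep hg x₀ z b a := hg.symm _ _ _

theorem metricRep_nondegenerate (hg : IsMetric g) {z : E} (hz : z ∈ (extChartAt I x₀).target)
    (a : E) (ha : ∀ b, metricRep hg x₀ z a b = 0) : a = 0 := by
  have hz' := mem_chart_source_of_target hz
  have : ofModel I x₀ ((extChartAt I x₀).symm z) a = 0 := hg.nondegenerate _ _ fun w => by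
    have hw := ha (toModel I x₀ _ w)
    rwa [metricRep_apply, ofModel_toModel hz'] at hw
  rw [← toModel_ofModel (I := I) hz' a, this, map_zero]

theorem endoRep_sq (hJ : IsAlmostComplex J) {z : E} (hz : z ∈ (extChartAt I x₀).target) (a : E) :
    endoRep hJ x₀ z (endoRep hJ x₀ z a) = -a := by
  have hz' := mem_chart_source_of_target hz
  rw [endoRep_apply, endoRep_apply, ofModel_toModel hz', hJ.sq, map_neg, toModel_ofModel hz']

theorem metricRep_endoRep (hg : IsMetric g) (hJ : IsAlmostComplex J) (h : IsSkewHermitian g J)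
    {z : E} (hz : z ∈ (extChartAt I x₀).target) (a b : E) :
    metricRep hg x₀ z (endoRep hJ x₀ z a) (endoRep hJ x₀ z b) = -metricRep hg x₀ z a b := by
  have hz' := mem_chart_source_of_target hz
  rw [metricRep_apply, endoRep_apply, endoRep_apply, ofModel_toModel hz', ofModel_toModel hz',
    h, metricRep_apply]

variable [I.Boundaryless]

theorem contDiffOn_metricRep (hg : IsMetric g) (x₀ : M) :
    ContDiffOn ℝ ∞ (metricRep hg x₀) (extChartAt I x₀).target := by
  refine contDiffOn_clm_apply.2 fun a => contDiffOn_clm_apply.2 fun b z hz => ?_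
  have hz' := mem_chart_source_of_target hz
  have h := hg.smooth _ _ _ (smoothFieldAt_fieldOfRep_const hz' a)
    (smoothFieldAt_fieldOfRep_const hz' b)
  rw [contMDiffAt_iff_contDiffAt_chart hz', (extChartAt I x₀).right_inv hz] at h
  exact h.contDiffWithinAt.congr_of_mem (fun z hz => rfl) hz

theorem contDiffOn_endoRep (hJ : IsAlmostComplex J) (x₀ : M) :
    ContDiffOn ℝ ∞ (endoRep hJ x₀) (extChartAt I x₀).target := by
  refine contDiffOn_clm_apply.2 fun a z hz => ?_
  have hz' := mem_chart_source_of_target hz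
  have h := hJ.smooth _ _ (smoothFieldAt_fieldOfRep_const hz' a)
  rw [smoothFieldAt_iff hz', (extChartAt I x₀).right_inv hz] at h
  exact h.contDiffWithinAt.congr_of_mem (fun z hz => rfl) hz

theorem contDiffAt_metricRep (hg : IsMetric g) (hx : x ∈ (chartAt H x₀).source) :
    ContDiffAt ℝ ∞ (metricRep hg x₀) (extChartAt I x₀ x) :=
  (contDiffOn_metricRep hg x₀).contDiffAt (extChartAt_target_mem_nhds_of_source hx)

theorem contDiffAt_endoRep (hJ : IsAlmostComplex J) (hx : x ∈ (chartAt H x₀).source) :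
    ContDiffAt ℝ ∞ (endoRep hJ x₀) (extChartAt I x₀ x) :=
  (contDiffOn_endoRep hJ x₀).contDiffAt (extChartAt_target_mem_nhds_of_source hx)

/-- The Christoffel symbols of a metric in the preferred chart at `x₀`. -/
def christoffelRep (hg : IsMetric g) (x₀ : M) : E → E →L[ℝ] E →L[ℝ] E :=
  modelChristoffel (metricRep hg x₀)

theorem contDiffOn_christoffelRep (hg : IsMetric g) (x₀ : M) :
    ContDiffOn ℝ ∞ (christoffelRep hg x₀) (extChartAt I x₀).target :=
  contDiffOn_modelChristoffel (isOpen_extChartAt_target x₀) (contDiffOn_metricRep hg x₀)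
    fun _ hz => metricRep_nondegenerate hg hz

theorem christoffelRep_symm (hg : IsMetric g) {z : E} (hz : z ∈ (extChartAt I x₀).target)
    (a b : E) : christoffelRep hg x₀ z a b = christoffelRep hg x₀ z b a :=
  modelChristoffel_symm (((contDiffOn_metricRep hg x₀).contDiffAt
    ((isOpen_extChartAt_target x₀).mem_nhds hz)).differentiableAt (by simp))
    (Eventually.of_forall fun z' => metricRep_symm hg x₀ z') a b

theorem fderiv_metricRep (hg : IsMetric g) {z : E} (hz : z ∈ (extChartAt I x₀).target)
    (a b c : E) : fderiv ℝ (metricRep hg x₀) z a b c =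
      metricRep hg x₀ z (christoffelRep hg x₀ z a b) c
        + metricRep hg x₀ z b (christoffelRep hg x₀ z a c) :=
  fderiv_metric_eq (((contDiffOn_metricRep hg x₀).contDiffAt
    ((isOpen_extChartAt_target x₀).mem_nhds hz)).differentiableAt (by simp))
    (Eventually.of_forall fun z' => metricRep_symm hg x₀ z')
    (metricRep_nondegenerate hg hz) a b c

/-- The derivative of a scalar product of vector fields, in a chart. -/
theorem dirDeriv_metric (hg : IsMetric g) (hx : x ∈ (chartAt H x₀).source) {Y Z : VField I M}
    (hY : SmoothFieldAt Y x) (hZ : SmoothFieldAt Z x) (v : TangentSpace I x) :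
    dirDeriv (fun y => g y (Y y) (Z y)) x v =
      fderiv ℝ (metricRep hg x₀) (extChartAt I x₀ x) (toModel I x₀ x v)
          (toModel I x₀ x (Y x)) (toModel I x₀ x (Z x))
        + metricRep hg x₀ (extChartAt I x₀ x)
          (fderiv ℝ (fieldRep x₀ Y) (extChartAt I x₀ x) (toModel I x₀ x v)) (toModel I x₀ x (Z x))
        + metricRep hg x₀ (extChartAt I x₀ x) (toModel I x₀ x (Y x))
          (fderiv ℝ (fieldRep x₀ Z) (extChartAt I x₀ x) (toModel I x₀ x v)) := by
  rw [dirDeriv_eq_fderiv hx (hg.smooth Y Z x hY hZ)]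
  have e : ((fun y => g y (Y y) (Z y)) ∘ (extChartAt I x₀).symm) =ᶠ[𝓝 (extChartAt I x₀ x)]
      fun z => metricRep hg x₀ z (fieldRep x₀ Y z) (fieldRep x₀ Z z) := by
    filter_upwards [extChartAt_target_mem_nhds_of_source hx] with z hz
    exact (metricRep_fieldRep hg hz Y Z).symm
  have hG := (contDiffAt_metricRep hg hx).differentiableAt (by simp)
  have hY' := hY.differentiableAt_fieldRep hx
  have hZ' := hZ.differentiableAt_fieldRep hx
  rw [e.fderiv_eq, fderiv_clm_apply (hG.clm_apply hY') hZ', fderiv_clm_apply hG hY']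
  simp only [fieldRep_extChartAt hx, add_apply,
    ContinuousLinearMap.comp_apply, ContinuousLinearMap.flip_apply]
  ring

/-- The Levi-Civita connection in a chart. -/
theorem toModel_leviCivita (hg : IsMetric g) (hx : x ∈ (chartAt H x₀).source) {Y : VField I M}
    (hY : SmoothFieldAt Y x) (v : TangentSpace I x) :
    toModel I x₀ x (leviCivita g Y x v) =
      fderiv ℝ (fieldRep x₀ Y) (extChartAt I x₀ x) (toModel I x₀ x v)
        + christoffelRep hg x₀ (extChartAt I x₀ x) (toModel I x₀ x v) (toModel I x₀ x (Y x)) := by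
  -- The candidate `∂ + Γ` is torsion-free because `Γ` is symmetric, and metric because of
  -- `fderiv_metricRep`.
  have hcomp := FiniteDimensional.complete ℝ E
  have hz := extChartAt_mem_target (I := I) hx
  rw [leviCivita_eq_of_torsionFree_of_metric hg (D := fun Y v => ofModel I x₀ x
    (fderiv ℝ (fieldRep x₀ Y) (extChartAt I x₀ x) (toModel I x₀ x v)
        + christoffelRep hg x₀ (extChartAt I x₀ x) (toModel I x₀ x v) (toModel I x₀ x (Y x))))
    ?_ ?_ hY v, toModel_ofModel hx]
  · intro X Y hX hY
    apply toModel_injective hx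
    rw [toModel_mlieBracket hx hX hY, map_sub, toModel_ofModel hx, toModel_ofModel hx,
      christoffelRep_symm hg hz (toModel I x₀ x (X x))]
    abel
  · intro Y Z hY hZ v
    rw [dirDeriv_metric hg hx hY hZ, ← metricRep_toModel hg hx, ← metricRep_toModel hg hx,
      toModel_ofModel hx, toModel_ofModel hx, fderiv_metricRep hg hz]
    simp only [map_add, add_apply]
    ring

theorem leviCivita_torsionFree (hg : IsMetric g) {X Y : VField I M}
    (hX : SmoothFieldAt X x) (hY : SmoothFieldAt Y x) :
    leviCivita g Y x (X x) - leviCivita g X x (Y x) = mlieBracket I X Y x := by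
  have hcomp := FiniteDimensional.complete ℝ E
  have hx := mem_chart_source H x
  apply toModel_injective hx
  rw [toModel_mlieBracket hx hX hY, map_sub, toModel_leviCivita hg hx hX,
    toModel_leviCivita hg hx hY,
    christoffelRep_symm hg (extChartAt_mem_target hx) (toModel I x x (X x))]
  abel

/-- A parallel almost complex structure is integrable. -/
theorem IsAlmostComplex.isComplex_of_parallel (hg : IsMetric g) (hJ : IsAlmostComplex J)
    (h : StructuralTensorVanishes g J) : IsComplex J := by
  refine ⟨hJ, fun X Y x hX hY => ?_⟩
  have hJX := hJ.smooth X x hX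
  have hJY := hJ.smooth Y x hY
  -- Each bracket becomes a difference of covariant derivatives; once `J` is moved out of them, the
  -- eight terms cancel in pairs.
  rw [nijenhuis, ← leviCivita_torsionFree hg hX hY, ← leviCivita_torsionFree hg hX hJY,
    ← leviCivita_torsionFree hg hJX hY, ← leviCivita_torsionFree hg hJX hJY,
    h.leviCivita_comm hg hX hY, h.leviCivita_comm hg hY hX, h.leviCivita_comm hg hJX hY,
    h.leviCivita_comm hg hJY hX, hJ.sub, hJ.sub, hJ.sq, hJ.sq]
  abel

end LeviCivita

/-! ### Induced charts of the tangent bundle -/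

section TangentChart

variable {E : Type*} [NormedAddCommGroup E] [NormedSpace ℝ E]
  {H : Type*} [TopologicalSpace H] {I : ModelWithCorners ℝ E H}
  {M : Type*} [TopologicalSpace M] [ChartedSpace H M] [IsManifold I ∞ M]

theorem extChartAt_tangent_apply (u₀ u : TangentBundle I M)
    (hu : u.proj ∈ (chartAt H u₀.proj).source) :
    extChartAt I.tangent u₀ u =
      (extChartAt I u₀.proj u.proj, toModel I u₀.proj u.proj u.2) := by
  rw [FiberBundle.extChartAt]
  refine Prod.ext rfl ?_
  exact ((trivializationAt E (TangentSpace I) u₀.proj).continuousLinearMapAt_apply_of_mem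
    (R := ℝ) hu u.2).symm

theorem extChartAt_tangent_symm_apply (u₀ : TangentBundle I M) {z : E × E}
    (hz : z.1 ∈ (extChartAt I u₀.proj).target) :
    (extChartAt I.tangent u₀).symm z =
      ⟨(extChartAt I u₀.proj).symm z.1, ofModel I u₀.proj _ z.2⟩ := by
  have hz' := mem_chart_source_of_target hz
  rw [FiberBundle.extChartAt, ofModel, Bundle.Trivialization.symmL_apply _ hz']
  exact ((trivializationAt E (TangentSpace I) u₀.proj).mk_symm hz' z.2).symm

/-- The extension has constant components in the chart at `p`; this links it to the slice of
constant fibre coordinate in the induced chart of `TM`. -/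
theorem extend_apply {p q : M} (hq : q ∈ (chartAt H p).source) (v : TangentSpace I p) :
    (FiberBundle.extend E v : VField I M) q = ofModel I p q (toModel I p p v) := by
  have h : toModel I p p v = (trivializationAt E (TangentSpace I) p ⟨p, v⟩).2 :=
    (trivializationAt E (TangentSpace I) p).continuousLinearMapAt_apply_of_mem
      (R := ℝ) (mem_chart_source H p) v
  rw [h, ofModel, Bundle.Trivialization.symmL_apply _ hq]
  rfl

theorem smoothFieldAt_extend {p : M} (v : TangentSpace I p) :
    SmoothFieldAt (FiberBundle.extend E v : VField I M) p :=
  FiberBundle.contMDiffAt_extend I E v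

theorem ofModel_self (p : M) (v : TangentSpace I p) : ofModel I p p v = v := by
  conv_lhs => rw [← toModel_self p v]
  exact ofModel_toModel (mem_chart_source H p) v

variable [I.Boundaryless]

/-- The components of a tangent vector to `TM` in a chart of `TM`. -/
theorem toModel_tangent_ofComponents (u₀ u : TangentBundle I M)
    (hu : u.proj ∈ (chartAt H u₀.proj).source) (ξ η : TangentSpace I u.proj) :
    toModel I.tangent u₀ u (ofComponents u ξ η) =
      (toModel I u₀.proj u.proj ξ,
        fderiv ℝ (fieldRep u₀.proj (FiberBundle.extend E u.2 : VField I M))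
          (extChartAt I u₀.proj u.proj) (toModel I u₀.proj u.proj ξ)
          + toModel I u₀.proj u.proj η) := by
  have hp := mem_chart_source H u.proj
  have hL : HasFDerivAt ((extChartAt I.tangent u₀) ∘ (extChartAt I.tangent u).symm)
      (tangentCoordChange I.tangent u u₀ u) (extChartAt I.tangent u u) := by
    have := hasFDerivWithinAt_tangentCoordChange (I := I.tangent) (x := u) (y := u₀) (z := u)
      ⟨mem_extChartAt_source u, by
        rw [extChartAt_source, TangentBundle.mem_chart_source_iff]; exact hu⟩
    rwa [I.tangent.range_eq_univ, hasFDerivWithinAt_univ] at this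
  have hL' : toModel I.tangent u₀ u (ofComponents u ξ η) =
      tangentCoordChange I.tangent u u₀ u (ofComponents u ξ η) :=
    toModel_eq_tangentCoordChange ((TangentBundle.mem_chart_source_iff u u₀).2 hu) _
  rw [hL']
  have hz : extChartAt I.tangent u u = (extChartAt I u.proj u.proj, toModel I u.proj u.proj u.2) :=
    extChartAt_tangent_apply u u hp
  rw [hz] at hL
  set L := tangentCoordChange I.tangent u u₀ u
  have hτ : HasFDerivAt ((extChartAt I u₀.proj) ∘ (extChartAt I u.proj).symm)
      (tangentCoordChange I u.proj u₀.proj u.proj) (extChartAt I u.proj u.proj) := by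
    have := hasFDerivWithinAt_tangentCoordChange (I := I) (x := u.proj) (y := u₀.proj)
      (z := u.proj) ⟨mem_extChartAt_source u.proj, by rwa [extChartAt_source]⟩
    rwa [I.range_eq_univ, hasFDerivWithinAt_univ] at this
  have hT : ∀ ζ : TangentSpace I u.proj, tangentCoordChange I u.proj u₀.proj u.proj ζ =
      toModel I u₀.proj u.proj ζ := fun ζ => (toModel_eq_tangentCoordChange hu ζ).symm
  set y : E := toModel I u.proj u.proj u.2 with hy
  set Y : VField I M := FiberBundle.extend E u.2 with hY
  have hcoord : ∀ z : E × E, z.1 ∈ (extChartAt I u.proj).target →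
      (extChartAt I u.proj).symm z.1 ∈ (chartAt H u₀.proj).source →
      ((extChartAt I.tangent u₀) ∘ (extChartAt I.tangent u).symm) z =
        (extChartAt I u₀.proj ((extChartAt I u.proj).symm z.1),
          toModel I u₀.proj ((extChartAt I u.proj).symm z.1)
            (ofModel I u.proj ((extChartAt I u.proj).symm z.1) z.2)) := by
    intro z hz1 hz2
    rw [Function.comp_apply, extChartAt_tangent_symm_apply u hz1]
    exact extChartAt_tangent_apply u₀ _ hz2
  have hx : extChartAt I u.proj u.proj ∈ (extChartAt I u.proj).target :=
    mem_extChartAt_target u.proj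
  have hsymm : (extChartAt I u.proj).symm (extChartAt I u.proj u.proj) = u.proj :=
    symm_extChartAt hp
  -- With the fibre coordinate `y` fixed, the transition map follows the extension `Y` of `u.2`,
  -- written in the chart at `u₀`. Its derivative is that of the components of `Y`, which contains
  -- the second derivative of the change of chart.
  have hor : L ((ξ, 0) : E × E) = (toModel I u₀.proj u.proj ξ,
      fderiv ℝ (fieldRep u₀.proj Y) (extChartAt I u₀.proj u.proj)
        (toModel I u₀.proj u.proj ξ)) := by
    have hslice : HasFDerivAt (fun x' : E => (x', y))
        ((ContinuousLinearMap.id ℝ E).prod (0 : E →L[ℝ] E)) (extChartAt I u.proj u.proj) :=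
      (hasFDerivAt_id _).prodMk (hasFDerivAt_const _ _)
    have h1 := hL.comp (extChartAt I u.proj u.proj) hslice
    have hYd : HasFDerivAt (fieldRep u₀.proj Y)
        (fderiv ℝ (fieldRep u₀.proj Y) (extChartAt I u₀.proj u.proj))
        (((extChartAt I u₀.proj) ∘ (extChartAt I u.proj).symm) (extChartAt I u.proj u.proj)) := by
      rw [Function.comp_apply, hsymm]
      exact ((smoothFieldAt_extend u.2).differentiableAt_fieldRep hu).hasFDerivAt
    have h2 := hτ.prodMk (hYd.comp (extChartAt I u.proj u.proj) hτ)
    have hev : (fun x' => (((extChartAt I u₀.proj) ∘ (extChartAt I u.proj).symm) x',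
          (fieldRep u₀.proj Y ∘ ((extChartAt I u₀.proj) ∘ (extChartAt I u.proj).symm)) x'))
        =ᶠ[𝓝 (extChartAt I u.proj u.proj)]
        (((extChartAt I.tangent u₀) ∘ (extChartAt I.tangent u).symm) ∘ fun x' : E => (x', y)) := by
      have hc : ContinuousAt (extChartAt I u.proj).symm (extChartAt I u.proj u.proj) :=
        continuousAt_extChartAt_symm u.proj
      have hn : (chartAt H u₀.proj).source ∈
          𝓝 ((extChartAt I u.proj).symm (extChartAt I u.proj u.proj)) := by
        rw [hsymm]; exact (chartAt H u₀.proj).open_source.mem_nhds hu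
      filter_upwards [hc hn, (isOpen_extChartAt_target u.proj).mem_nhds hx] with x' h1 h2
      have h1' : (extChartAt I u.proj).symm x' ∈ (chartAt H u₀.proj).source := h1
      rw [Function.comp_apply (x := x') (g := fun x' : E => (x', y)), hcoord (x', y) h2 h1']
      refine Prod.ext rfl ?_
      change fieldRep u₀.proj Y (extChartAt I u₀.proj ((extChartAt I u.proj).symm x')) = _
      rw [fieldRep_extChartAt h1', hY, extend_apply (mem_chart_source_of_target h2)]
    have h3 := (h2.congr_of_eventuallyEq hev.symm).unique h1
    have h4 := DFunLike.congr_fun h3 ξ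
    refine h4.symm.trans ?_
    exact Prod.ext (hT ξ)
      (congrArg (fderiv ℝ (fieldRep u₀.proj Y) (extChartAt I u₀.proj u.proj)) (hT ξ))
  -- Along the fibre over `u.proj` the transition map is linear, hence its own derivative.
  have ver : L ((0, η) : E × E) = (0, toModel I u₀.proj u.proj η) := by
    have hslice : HasFDerivAt (fun y' : E => (extChartAt I u.proj u.proj, y'))
        ((0 : E →L[ℝ] E).prod (ContinuousLinearMap.id ℝ E)) y :=
      (hasFDerivAt_const _ _).prodMk (hasFDerivAt_id _)
    have h1 := hL.comp y hslice
    have h2 : HasFDerivAt (fun y' : E => (extChartAt I u₀.proj u.proj,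
          toModel I u₀.proj u.proj (ofModel I u.proj u.proj y')))
        ((0 : E →L[ℝ] E).prod ((toModel I u₀.proj u.proj).comp (ofModel I u.proj u.proj))) y :=
      (hasFDerivAt_const _ _).prodMk
        ((toModel I u₀.proj u.proj).comp (ofModel I u.proj u.proj)).hasFDerivAt
    have hev : (((extChartAt I.tangent u₀) ∘ (extChartAt I.tangent u).symm) ∘
        fun y' : E => (extChartAt I u.proj u.proj, y')) =
        fun y' : E => (extChartAt I u₀.proj u.proj,
          toModel I u₀.proj u.proj (ofModel I u.proj u.proj y')) := by
      funext y'
      rw [Function.comp_apply, hcoord (extChartAt I u.proj u.proj, y') hx (by rw [hsymm]; exact hu)]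
      have : ∀ q, q = u.proj → (extChartAt I u₀.proj q,
          toModel I u₀.proj q (ofModel I u.proj q y')) =
          (extChartAt I u₀.proj u.proj, toModel I u₀.proj u.proj (ofModel I u.proj u.proj y')) := by
        rintro q rfl; rfl
      exact this _ hsymm
    rw [hev] at h1
    have h4 := DFunLike.congr_fun (h1.unique h2) η
    refine h4.trans ?_
    refine Prod.ext rfl ?_
    change toModel I u₀.proj u.proj (ofModel I u.proj u.proj η) = _
    rw [ofModel_self]
  have hsum : (ofComponents u ξ η : E × E) = ((ξ, 0) : E × E) + ((0, η) : E × E) := by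
    refine Prod.ext ?_ ?_
    · exact (add_zero (ξ : E)).symm
    · exact (zero_add (η : E)).symm
  have := L.map_add ((ξ, 0) : E × E) ((0, η) : E × E)
  rw [hor, ver] at this
  refine (congrArg L hsum).trans (this.trans (Prod.ext ?_ rfl))
  exact add_zero _

end TangentChart

/-! ### Horizontal and vertical parts in a vector space: bracket and metric -/

section ModelTangent

variable {E : Type*} [NormedAddCommGroup E] [NormedSpace ℝ E]

/-- The horizontal and vertical parts of `w`, a tangent vector at `z = (x, y)`, with respect to a
connection with Christoffel symbols `Γ`. -/
def hvShear (Γ : E → E →L[ℝ] E →L[ℝ] E) (z w : E × E) : E × E :=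
  (w.1, w.2 + Γ z.1 w.1 z.2)

/-- The tangent vector at `z = (x, y)` with given horizontal and vertical parts. -/
def hvUnshear (Γ : E → E →L[ℝ] E →L[ℝ] E) (z c : E × E) : E × E :=
  (c.1, c.2 - Γ z.1 c.1 z.2)

/-- The covariant derivative, in direction `w`, of the horizontal and vertical parts `Q` of a
vector field. -/
def hvDeriv (Γ : E → E →L[ℝ] E →L[ℝ] E) (Q : E × E → E × E) (z w : E × E) : E × E :=
  fderiv ℝ Q z w + (Γ z.1 w.1 (Q z).1, Γ z.1 w.1 (Q z).2)

/-- The curvature of a connection with Christoffel symbols `Γ`. -/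
def modelCurvature (Γ : E → E →L[ℝ] E →L[ℝ] E) (x a b c : E) : E :=
  fderiv ℝ Γ x a b c - fderiv ℝ Γ x b a c + Γ x a (Γ x b c) - Γ x b (Γ x a c)

variable {Γ : E → E →L[ℝ] E →L[ℝ] E} {z : E × E} {P Q : E × E → E × E}

theorem hvShear_hvUnshear (z c : E × E) : hvShear Γ z (hvUnshear Γ z c) = c :=
  Prod.ext rfl (sub_add_cancel _ _)

theorem hvUnshear_hvShear (z w : E × E) : hvUnshear Γ z (hvShear Γ z w) = w :=
  Prod.ext rfl (add_sub_cancel_right _ _)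

theorem hasFDerivAt_connection_apply (hΓ : DifferentiableAt ℝ Γ z.1)
    (hQ : DifferentiableAt ℝ Q z) (w : E × E) :
    DifferentiableAt ℝ (fun z' => Γ z'.1 (Q z').1 z'.2) z ∧
      fderiv ℝ (fun z' => Γ z'.1 (Q z').1 z'.2) z w =
      fderiv ℝ Γ z.1 w.1 (Q z).1 z.2 + Γ z.1 (fderiv ℝ Q z w).1 z.2 + Γ z.1 (Q z).1 w.2 := by
  have h1 : HasFDerivAt (fun z' : E × E => Γ z'.1)
      ((fderiv ℝ Γ z.1).comp (ContinuousLinearMap.fst ℝ E E)) z :=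
    hΓ.hasFDerivAt.comp z hasFDerivAt_fst
  have h := ((h1.clm_apply hQ.hasFDerivAt.fst).clm_apply (hasFDerivAt_snd (p := z)))
  refine ⟨h.differentiableAt, ?_⟩
  rw [h.fderiv]
  simp only [add_apply, ContinuousLinearMap.comp_apply, ContinuousLinearMap.flip_apply,
    ContinuousLinearMap.coe_fst', ContinuousLinearMap.coe_snd']
  abel

theorem fderiv_hvUnshear (hΓ : DifferentiableAt ℝ Γ z.1)
    (hQ : DifferentiableAt ℝ Q z) (w : E × E) :
    fderiv ℝ (fun z' => hvUnshear Γ z' (Q z')) z w =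
      ((fderiv ℝ Q z w).1, (fderiv ℝ Q z w).2 -
        (fderiv ℝ Γ z.1 w.1 (Q z).1 z.2 + Γ z.1 (fderiv ℝ Q z w).1 z.2
          + Γ z.1 (Q z).1 w.2)) := by
  obtain ⟨h1, h2⟩ := hasFDerivAt_connection_apply hΓ hQ w
  have h := hQ.hasFDerivAt.fst.prodMk (hQ.hasFDerivAt.snd.sub h1.hasFDerivAt)
  have h' : HasFDerivAt (fun z' => hvUnshear Γ z' (Q z')) _ z := h
  rw [h'.fderiv]
  refine Prod.ext rfl ?_
  simp [h2]

/-- The Lie bracket of vector fields given by their horizontal and vertical parts. -/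
theorem hvShear_bracket (hΓ : DifferentiableAt ℝ Γ z.1)
    (hsymm : ∀ a b, Γ z.1 a b = Γ z.1 b a)
    (hP : DifferentiableAt ℝ P z) (hQ : DifferentiableAt ℝ Q z) :
    hvShear Γ z (fderiv ℝ (fun z' => hvUnshear Γ z' (Q z')) z (hvUnshear Γ z (P z))
        - fderiv ℝ (fun z' => hvUnshear Γ z' (P z')) z (hvUnshear Γ z (Q z))) =
      hvDeriv Γ Q z (hvUnshear Γ z (P z)) - hvDeriv Γ P z (hvUnshear Γ z (Q z))
        - (0, modelCurvature Γ z.1 (P z).1 (Q z).1 z.2) := by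
  rw [fderiv_hvUnshear hΓ hQ, fderiv_hvUnshear hΓ hP]
  -- In the horizontal part the Christoffel terms cancel by symmetry of `Γ`. In the vertical part
  -- the derivatives of `Γ` and the products of two `Γ` assemble into the curvature.
  refine Prod.ext ?_ ?_
  · simp only [hvShear, hvDeriv, hvUnshear, Prod.fst_sub, Prod.fst_add, hsymm (P z).1 (Q z).1]
    abel
  · simp only [hvShear, hvDeriv, hvUnshear, modelCurvature, Prod.fst_sub,
      Prod.snd_sub, Prod.snd_add, map_sub, sub_apply]
    abel

/-- The derivative of a scalar product of vector fields given by their horizontal and vertical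
parts. -/
theorem fderiv_hv_metric {G : E → E →L[ℝ] E →L[ℝ] ℝ} (hG : DifferentiableAt ℝ G z.1)
    (hmet : ∀ a b c, fderiv ℝ G z.1 a b c = G z.1 (Γ z.1 a b) c + G z.1 b (Γ z.1 a c))
    (hP : DifferentiableAt ℝ P z) (hQ : DifferentiableAt ℝ Q z) (w : E × E) :
    fderiv ℝ (fun z' => G z'.1 (P z').1 (Q z').1 + G z'.1 (P z').2 (Q z').2) z w =
      (G z.1 (hvDeriv Γ P z w).1 (Q z).1 + G z.1 (hvDeriv Γ P z w).2 (Q z).2)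
        + (G z.1 (P z).1 (hvDeriv Γ Q z w).1 + G z.1 (P z).2 (hvDeriv Γ Q z w).2) := by
  have h1 : HasFDerivAt (fun z' : E × E => G z'.1)
      ((fderiv ℝ G z.1).comp (ContinuousLinearMap.fst ℝ E E)) z :=
    hG.hasFDerivAt.comp z hasFDerivAt_fst
  have h := ((h1.clm_apply hP.hasFDerivAt.fst).clm_apply hQ.hasFDerivAt.fst).add
    ((h1.clm_apply hP.hasFDerivAt.snd).clm_apply hQ.hasFDerivAt.snd)
  have h' : HasFDerivAt (fun z' => G z'.1 (P z').1 (Q z').1 + G z'.1 (P z').2 (Q z').2) _ z := h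
  rw [h'.fderiv]
  simp only [add_apply, ContinuousLinearMap.comp_apply, ContinuousLinearMap.flip_apply,
    ContinuousLinearMap.coe_fst', ContinuousLinearMap.coe_snd', hmet, hvDeriv, Prod.fst_add,
    Prod.snd_add, map_add]
  ring

end ModelTangent

/-! ### The Sasaki metric and its Levi-Civita connection over flat points -/

section Sasaki

variable {E : Type*} [NormedAddCommGroup E] [NormedSpace ℝ E]
  {H : Type*} [TopologicalSpace H] {I : ModelWithCorners ℝ E H}
  {M : Type*} [TopologicalSpace M] [ChartedSpace H M] [IsManifold I ∞ M]
  {g : BilinField I M} {J : EndoField I M}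

/-- The components of the horizontal and vertical parts of a tangent vector to `TM`, in the
preferred chart of `M` at `p₀`. -/
def hvAt (g : BilinField I M) (p₀ : M) (u : TangentBundle I M) (A : TangentSpace I.tangent u) :
    E × E :=
  (toModel I p₀ u.proj (hPart u A), toModel I p₀ u.proj (vPart g u A))

variable {u₀ u : TangentBundle I M}

theorem mem_chart_source_tangent (hu : u.proj ∈ (chartAt H u₀.proj).source) :
    u ∈ (chartAt (ModelProd H E) u₀).source :=
  (TangentBundle.mem_chart_source_iff u u₀).2 hu

variable [FiniteDimensional ℝ E]

theorem sasaki_eq (hg : IsMetric g) (hu : u.proj ∈ (chartAt H u₀.proj).source)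
    (A B : TangentSpace I.tangent u) :
    sasaki g u A B =
      metricRep hg u₀.proj (extChartAt I u₀.proj u.proj)
          (hvAt g u₀.proj u A).1 (hvAt g u₀.proj u B).1
        + metricRep hg u₀.proj (extChartAt I u₀.proj u.proj)
          (hvAt g u₀.proj u A).2 (hvAt g u₀.proj u B).2 := by
  rw [hvAt, hvAt, metricRep_toModel hg hu, metricRep_toModel hg hu]
  rfl

/-- The components of the horizontal and vertical parts of a vector field on `TM`. -/
def hvRep (hg : IsMetric g) (u₀ : TangentBundle I M) (W : VField I.tangent (TangentBundle I M))
    (z : E × E) : E × E :=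
  hvShear (christoffelRep hg u₀.proj) z (fieldRep u₀ W z)

/-- The vector field on `TM` with given components of the horizontal and vertical parts. -/
def hvField (hg : IsMetric g) (u₀ : TangentBundle I M) (P : E × E → E × E) :
    VField I.tangent (TangentBundle I M) :=
  fieldOfRep I.tangent u₀ fun z => hvUnshear (christoffelRep hg u₀.proj) z (P z)

theorem fieldRep_eq_hvUnshear (hg : IsMetric g) (u₀ : TangentBundle I M)
    (W : VField I.tangent (TangentBundle I M)) :
    fieldRep u₀ W = fun z => hvUnshear (christoffelRep hg u₀.proj) z (hvRep hg u₀ W z) := by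
  funext z
  rw [hvRep, hvUnshear_hvShear]

theorem hvRep_hvField (hg : IsMetric g) {u₀ : TangentBundle I M} {z : E × E}
    (hz : z ∈ (extChartAt I.tangent u₀).target) (P : E × E → E × E) :
    hvRep hg u₀ (hvField hg u₀ P) z = P z := by
  rw [hvRep, hvField, fieldRep_fieldOfRep hz, hvShear_hvUnshear]

variable [I.Boundaryless]

/-- The inhomogeneous transformation law of Christoffel symbols from the chart at `p` to the chart
at `p₀`. -/
theorem toModel_christoffel (hg : IsMetric g) {p p₀ : M} (hp : p ∈ (chartAt H p₀).source)
    (ξ η : TangentSpace I p) :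
    toModel I p₀ p (christoffel g p ξ η) =
      fderiv ℝ (fieldRep p₀ (FiberBundle.extend E η : VField I M)) (extChartAt I p₀ p)
          (toModel I p₀ p ξ)
        + christoffelRep hg p₀ (extChartAt I p₀ p) (toModel I p₀ p ξ) (toModel I p₀ p η) := by
  rw [christoffel, toModel_leviCivita hg hp (smoothFieldAt_extend η),
    FiberBundle.extend_apply_self]

/-- The splitting does not depend on the chart: the inhomogeneous term of `toModel_christoffel` is
the one produced by the transition map of `TM` in `toModel_tangent_ofComponents`. Lifts defined at
each point in its own chart can thus be differentiated in a single chart. -/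
theorem hvShear_toModel (hg : IsMetric g) (hu : u.proj ∈ (chartAt H u₀.proj).source)
    (A : TangentSpace I.tangent u) :
    hvShear (christoffelRep hg u₀.proj) (extChartAt I.tangent u₀ u) (toModel I.tangent u₀ u A) =
      hvAt g u₀.proj u A := by
  rw [extChartAt_tangent_apply u₀ u hu]
  change hvShear _ _ (toModel I.tangent u₀ u (ofComponents u (dx u A) (dy u A))) = _
  rw [toModel_tangent_ofComponents u₀ u hu]
  refine Prod.ext rfl ?_
  change _ = toModel I u₀.proj u.proj (dy u A + christoffel g u.proj (dx u A) u.2)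
  rw [map_add, toModel_christoffel hg hu]
  simp only [hvShear]
  abel

theorem hvRep_extChartAt (hg : IsMetric g) (hu : u.proj ∈ (chartAt H u₀.proj).source)
    (W : VField I.tangent (TangentBundle I M)) :
    hvRep hg u₀ W (extChartAt I.tangent u₀ u) = hvAt g u₀.proj u (W u) := by
  rw [hvRep, fieldRep_extChartAt (mem_chart_source_tangent hu), hvShear_toModel hg hu]

theorem toModel_eq_hvUnshear (hg : IsMetric g) (hu : u.proj ∈ (chartAt H u₀.proj).source)
    (A : TangentSpace I.tangent u) :
    toModel I.tangent u₀ u A = hvUnshear (christoffelRep hg u₀.proj) (extChartAt I.tangent u₀ u)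
      (hvAt g u₀.proj u A) := by
  rw [← hvShear_toModel hg hu, hvUnshear_hvShear]

theorem hvAt_injective (hg : IsMetric g) (hu : u.proj ∈ (chartAt H u₀.proj).source) :
    Function.Injective (hvAt g u₀.proj u) := fun A B h => by
  apply toModel_injective (mem_chart_source_tangent hu)
  rw [toModel_eq_hvUnshear hg hu, toModel_eq_hvUnshear hg hu, h]

/-- Linearity in `A` is not visible from `christoffel`, which is defined by choice; it is read off
in the chart, where `Γ` is bilinear. -/
theorem vPart_add (hg : IsMetric g) (A B : TangentSpace I.tangent u) :
    vPart g u (A + B) = vPart g u A + vPart g u B := by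
  have hu := mem_chart_source H u.proj
  apply toModel_injective hu
  change (hvAt g u.proj u (A + B)).2 = _
  rw [← hvShear_toModel hg hu, map_add, map_add]
  change _ = (hvAt g u.proj u A).2 + (hvAt g u.proj u B).2
  rw [← hvShear_toModel hg hu, ← hvShear_toModel hg hu]
  simp only [hvShear, Prod.fst_add, Prod.snd_add, map_add, add_apply]
  abel

theorem vPart_smul (hg : IsMetric g) (c : ℝ) (A : TangentSpace I.tangent u) :
    vPart g u (c • A) = c • vPart g u A := by
  have hu := mem_chart_source H u.proj
  apply toModel_injective hu
  change (hvAt g u.proj u (c • A)).2 = _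
  rw [← hvShear_toModel hg hu, map_smul, map_smul]
  change _ = c • (hvAt g u.proj u A).2
  rw [← hvShear_toModel hg hu]
  simp only [hvShear, Prod.smul_fst, Prod.smul_snd, map_smul, smul_apply, smul_add]

theorem hvAt_add (hg : IsMetric g) (p₀ : M) (A B : TangentSpace I.tangent u) :
    hvAt g p₀ u (A + B) = hvAt g p₀ u A + hvAt g p₀ u B := by
  refine Prod.ext (map_add (toModel I p₀ u.proj) (hPart u A) (hPart u B)) ?_
  rw [hvAt, vPart_add hg, map_add]
  rfl

theorem hvAt_smul (hg : IsMetric g) (p₀ : M) (c : ℝ) (A : TangentSpace I.tangent u) :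
    hvAt g p₀ u (c • A) = c • hvAt g p₀ u A := by
  refine Prod.ext (map_smul (toModel I p₀ u.proj) c (hPart u A)) ?_
  rw [hvAt, vPart_smul hg, map_smul]
  rfl

theorem hvAt_sub (hg : IsMetric g) (p₀ : M) (A B : TangentSpace I.tangent u) :
    hvAt g p₀ u (A - B) = hvAt g p₀ u A - hvAt g p₀ u B := by
  rw [sub_eq_add_neg, hvAt_add hg, ← neg_one_smul ℝ B, hvAt_smul hg, neg_one_smul, sub_eq_add_neg]

theorem contDiffAt_christoffelRep_fst (hg : IsMetric g)
    (hu : u.proj ∈ (chartAt H u₀.proj).source) :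
    ContDiffAt ℝ ∞ (christoffelRep hg u₀.proj) (extChartAt I.tangent u₀ u).1 := by
  rw [extChartAt_tangent_apply u₀ u hu]
  exact (contDiffOn_christoffelRep hg u₀.proj).contDiffAt (extChartAt_target_mem_nhds_of_source hu)

theorem SmoothFieldAt.contDiffAt_hvRep (hg : IsMetric g)
    {W : VField I.tangent (TangentBundle I M)} (hW : SmoothFieldAt W u)
    (hu : u.proj ∈ (chartAt H u₀.proj).source) :
    ContDiffAt ℝ ∞ (hvRep hg u₀ W) (extChartAt I.tangent u₀ u) := by
  have h1 := hW.contDiffAt_fieldRep (mem_chart_source_tangent hu)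
  have h2 := (contDiffAt_christoffelRep_fst hg hu).comp (extChartAt I.tangent u₀ u) contDiffAt_fst
  exact h1.fst.prodMk (h1.snd.add ((h2.clm_apply h1.fst).clm_apply contDiffAt_snd))

theorem smoothFieldAt_hvField (hg : IsMetric g) {P : E × E → E × E}
    (hP : ContDiffAt ℝ ∞ P (extChartAt I.tangent u₀ u))
    (hu : u.proj ∈ (chartAt H u₀.proj).source) : SmoothFieldAt (hvField hg u₀ P) u := by
  have h2 := (contDiffAt_christoffelRep_fst hg hu).comp (extChartAt I.tangent u₀ u) contDiffAt_fst
  exact smoothFieldAt_fieldOfRep (mem_chart_source_tangent hu)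
    (hP.fst.prodMk (hP.snd.sub ((h2.clm_apply hP.fst).clm_apply contDiffAt_snd)))

theorem SmoothFieldAt.differentiableAt_hvRep (hg : IsMetric g)
    {W : VField I.tangent (TangentBundle I M)} (hW : SmoothFieldAt W u)
    (hu : u.proj ∈ (chartAt H u₀.proj).source) :
    DifferentiableAt ℝ (hvRep hg u₀ W) (extChartAt I.tangent u₀ u) :=
  (hW.contDiffAt_hvRep hg hu).differentiableAt (by simp)

/-- The Lie bracket on `TM` in terms of horizontal and vertical parts. -/
theorem hvAt_mlieBracket (hg : IsMetric g) {X Y : VField I.tangent (TangentBundle I M)}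
    (hX : SmoothFieldAt X u) (hY : SmoothFieldAt Y u)
    (hu : u.proj ∈ (chartAt H u₀.proj).source) :
    hvAt g u₀.proj u (mlieBracket I.tangent X Y u) =
      hvDeriv (christoffelRep hg u₀.proj) (hvRep hg u₀ Y) (extChartAt I.tangent u₀ u)
          (toModel I.tangent u₀ u (X u))
        - hvDeriv (christoffelRep hg u₀.proj) (hvRep hg u₀ X) (extChartAt I.tangent u₀ u)
          (toModel I.tangent u₀ u (Y u))
        - (0, modelCurvature (christoffelRep hg u₀.proj) (extChartAt I u₀.proj u.proj)
            (hvAt g u₀.proj u (X u)).1 (hvAt g u₀.proj u (Y u)).1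
            (toModel I u₀.proj u.proj u.2)) := by
  have hcomp := FiniteDimensional.complete ℝ E
  have hu' := mem_chart_source_tangent hu
  have hz := extChartAt_tangent_apply u₀ u hu
  rw [← hvShear_toModel hg hu, toModel_mlieBracket hu' hX hY, fieldRep_eq_hvUnshear hg,
    fieldRep_eq_hvUnshear hg, toModel_eq_hvUnshear hg hu (X u), toModel_eq_hvUnshear hg hu (Y u),
    ← hvRep_extChartAt hg hu X, ← hvRep_extChartAt hg hu Y]
  refine (hvShear_bracket ((contDiffAt_christoffelRep_fst hg hu).differentiableAt (by simp)) ?_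
    (hX.differentiableAt_hvRep hg hu) (hY.differentiableAt_hvRep hg hu)).trans ?_
  · rw [hz]
    exact christoffelRep_symm hg (extChartAt_mem_target hu)
  · rw [hz]

/-- In the splitting the coefficients of the metric depend on the base point only, so
`fderiv_hv_metric` applies to it. -/
theorem sasaki_chart_eventuallyEq (hg : IsMetric g) (hu : u.proj ∈ (chartAt H u₀.proj).source)
    (X Y : VField I.tangent (TangentBundle I M)) :
    ((fun v => sasaki g v (X v) (Y v)) ∘ (extChartAt I.tangent u₀).symm)
      =ᶠ[𝓝 (extChartAt I.tangent u₀ u)] fun z =>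
        metricRep hg u₀.proj z.1 (hvRep hg u₀ X z).1 (hvRep hg u₀ Y z).1
          + metricRep hg u₀.proj z.1 (hvRep hg u₀ X z).2 (hvRep hg u₀ Y z).2 := by
  filter_upwards [extChartAt_target_mem_nhds_of_source (mem_chart_source_tangent hu)] with z hz
  have hv := (TangentBundle.mem_chart_source_iff _ u₀).1 (mem_chart_source_of_target hz)
  have hz' := (extChartAt I.tangent u₀).right_inv hz
  have hz1 := congrArg Prod.fst (extChartAt_tangent_apply u₀ _ hv)
  rw [hz'] at hz1
  have hX := hvRep_extChartAt hg hv X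
  have hY := hvRep_extChartAt hg hv Y
  rw [hz'] at hX hY
  rw [Function.comp_apply, sasaki_eq hg hv, hX, hY, hz1]

theorem contDiffAt_metricRep_fst (hg : IsMetric g)
    (hu : u.proj ∈ (chartAt H u₀.proj).source) :
    ContDiffAt ℝ ∞ (metricRep hg u₀.proj) (extChartAt I.tangent u₀ u).1 := by
  rw [extChartAt_tangent_apply u₀ u hu]
  exact contDiffAt_metricRep hg hu

theorem isMetric_sasaki (hg : IsMetric g) : IsMetric (sasaki g) where
  add_left u A A' B := by
    have hu := mem_chart_source H u.proj
    rw [sasaki_eq hg hu, sasaki_eq hg hu, sasaki_eq hg hu, hvAt_add hg]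
    simp only [Prod.fst_add, Prod.snd_add, map_add, add_apply]
    ring
  smul_left u c A B := by
    have hu := mem_chart_source H u.proj
    rw [sasaki_eq hg hu, sasaki_eq hg hu, hvAt_smul hg]
    simp only [Prod.smul_fst, Prod.smul_snd, map_smul, smul_apply, smul_eq_mul]
    ring
  symm u A B := by
    rw [sasaki, sasaki, hg.symm, hg.symm _ (vPart g u A)]
  nondegenerate u A hA := by
    have hu := mem_chart_source H u.proj
    have hx := extChartAt_mem_target (I := I) hu
    -- Every pair `c` consists of the parts of some tangent vector; the choices `(b, 0)` and `(0,
    -- b)` below test the two parts separately.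
    have hA' : ∀ c : E × E, metricRep hg u.proj (extChartAt I u.proj u.proj)
        (hvAt g u.proj u A).1 c.1 + metricRep hg u.proj (extChartAt I u.proj u.proj)
        (hvAt g u.proj u A).2 c.2 = 0 := fun c => by
      have h := hA (ofModel I.tangent u u
        (hvUnshear (christoffelRep hg u.proj) (extChartAt I.tangent u u) c))
      rw [sasaki_eq hg hu, ← hvShear_toModel hg hu (ofModel _ _ _ _),
        toModel_ofModel (mem_chart_source_tangent hu), hvShear_hvUnshear] at h
      exact h
    have h1 : (hvAt g u.proj u A).1 = 0 := metricRep_nondegenerate hg hx _ fun b => by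
      simpa using hA' (b, 0)
    have h2 : (hvAt g u.proj u A).2 = 0 := metricRep_nondegenerate hg hx _ fun b => by
      simpa using hA' (0, b)
    apply toModel_injective (mem_chart_source_tangent hu)
    have h0 : hvAt g u.proj u A = 0 := Prod.ext h1 h2
    rw [toModel_eq_hvUnshear hg hu, h0, map_zero]
    simp [hvUnshear]
  smooth X Y u hX hY := by
    have hu := mem_chart_source H u.proj
    rw [contMDiffAt_iff_contDiffAt_chart (mem_chart_source_tangent hu)]
    refine ContDiffAt.congr_of_eventuallyEq ?_ (sasaki_chart_eventuallyEq hg hu X Y)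
    have hX' := hX.contDiffAt_hvRep hg hu
    have hY' := hY.contDiffAt_hvRep hg hu
    have hG := (contDiffAt_metricRep_fst hg hu).comp (extChartAt I.tangent u u) contDiffAt_fst
    exact ((hG.clm_apply hX'.fst).clm_apply hY'.fst).add
      ((hG.clm_apply hX'.snd).clm_apply hY'.snd)

/-- The Levi-Civita connection of the Sasaki metric at the points where the curvature of `g`
vanishes. -/
theorem hvAt_leviCivita_sasaki (hg : IsMetric g) (hu : u.proj ∈ (chartAt H u₀.proj).source)
    (hflat : ∀ a b c,
      modelCurvature (christoffelRep hg u₀.proj) (extChartAt I u₀.proj u.proj) a b c = 0)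
    {Y : VField I.tangent (TangentBundle I M)} (hY : SmoothFieldAt Y u)
    (A : TangentSpace I.tangent u) :
    hvAt g u₀.proj u (leviCivita (sasaki g) Y u A) =
      hvDeriv (christoffelRep hg u₀.proj) (hvRep hg u₀ Y) (extChartAt I.tangent u₀ u)
        (toModel I.tangent u₀ u A) := by
  have hu' := mem_chart_source_tangent hu
  have hz := extChartAt_tangent_apply u₀ u hu
  have hD : ∀ c : E × E, hvAt g u₀.proj u (ofModel I.tangent u₀ u
      (hvUnshear (christoffelRep hg u₀.proj) (extChartAt I.tangent u₀ u) c)) = c := fun c => by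
    rw [← hvShear_toModel hg hu, toModel_ofModel hu', hvShear_hvUnshear]
  rw [leviCivita_eq_of_torsionFree_of_metric (isMetric_sasaki hg)
    (D := fun Y A => ofModel I.tangent u₀ u
      (hvUnshear (christoffelRep hg u₀.proj) (extChartAt I.tangent u₀ u)
        (hvDeriv (christoffelRep hg u₀.proj) (hvRep hg u₀ Y) (extChartAt I.tangent u₀ u)
        (toModel I.tangent u₀ u A)))) ?_ ?_ hY A, hD]
  · intro X Y hX hY
    apply hvAt_injective hg hu
    -- Flatness enters only here: it removes the torsion of `hvDeriv`.
    rw [hvAt_mlieBracket hg hX hY hu, hvAt_sub hg, hD, hD, hflat]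
    exact (sub_zero _).symm
  · intro Y Z hY hZ v
    rw [dirDeriv_eq_fderiv hu' ((isMetric_sasaki hg).smooth Y Z u hY hZ),
      (sasaki_chart_eventuallyEq hg hu Y Z).fderiv_eq,
      fderiv_hv_metric (Γ := christoffelRep hg u₀.proj)
        ((contDiffAt_metricRep_fst hg hu).differentiableAt (by simp)) ?_
        (hY.differentiableAt_hvRep hg hu) (hZ.differentiableAt_hvRep hg hu),
      sasaki_eq hg hu, sasaki_eq hg hu, hD, hD, hvRep_extChartAt hg hu, hvRep_extChartAt hg hu, hz]
    rw [hz]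
    exact fderiv_metricRep hg (extChartAt_mem_target hu)

end Sasaki

/-! ### Covariant derivative of an endomorphism field acting on the two parts -/

section ModelEndo

variable {E : Type*} [NormedAddCommGroup E] [NormedSpace ℝ E]

/-- The covariant derivative of a field of endomorphisms `J` of a vector space. -/
def modelNabla (Γ : E → E →L[ℝ] E →L[ℝ] E) (J : E → E →L[ℝ] E) (x a b : E) : E :=
  fderiv ℝ J x a b + Γ x a (J x b) - J x (Γ x a b)

/-- The covariant derivative, in the horizontal direction `ξ`, of a field of endomorphisms that
acts on horizontal and vertical parts by `K`. -/
def hvNabla (Γ : E → E →L[ℝ] E →L[ℝ] E) (K : E → E × E →L[ℝ] E × E) (x ξ : E) (c : E × E) :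
    E × E :=
  fderiv ℝ K x ξ c + (Γ x ξ (K x c).1, Γ x ξ (K x c).2) - K x (Γ x ξ c.1, Γ x ξ c.2)

variable {Γ : E → E →L[ℝ] E →L[ℝ] E} {z : E × E} {Q : E × E → E × E}
  {K : E → E × E →L[ℝ] E × E}

theorem hvDeriv_congr {Q' : E × E → E × E} (h : Q =ᶠ[𝓝 z] Q') (w : E × E) :
    hvDeriv Γ Q z w = hvDeriv Γ Q' z w := by
  rw [hvDeriv, hvDeriv, h.fderiv_eq, h.self_of_nhds]

theorem hvDeriv_const (c w : E × E) :
    hvDeriv Γ (fun _ => c) z w = (Γ z.1 w.1 c.1, Γ z.1 w.1 c.2) := by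
  simp [hvDeriv]

/-- Leibniz rule. Since `K` is constant along the fibres, its derivative sees only the horizontal
part of `w`. -/
theorem hvDeriv_clm_apply (hK : DifferentiableAt ℝ K z.1) (hQ : DifferentiableAt ℝ Q z)
    (w : E × E) :
    hvDeriv Γ (fun z' => K z'.1 (Q z')) z w =
      K z.1 (hvDeriv Γ Q z w) + hvNabla Γ K z.1 w.1 (Q z) := by
  have h1 : HasFDerivAt (fun z' : E × E => K z'.1)
      ((fderiv ℝ K z.1).comp (ContinuousLinearMap.fst ℝ E E)) z :=
    hK.hasFDerivAt.comp z hasFDerivAt_fst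
  rw [hvDeriv, hvDeriv, hvNabla, (h1.clm_apply hQ.hasFDerivAt).fderiv]
  simp only [add_apply, ContinuousLinearMap.comp_apply, ContinuousLinearMap.flip_apply,
    ContinuousLinearMap.coe_fst', map_add]
  abel

end ModelEndo

/-! ### Structural and Nijenhuis tensors of a structure on `TM` in the splitting -/

section HVEndo

variable {E : Type*} [NormedAddCommGroup E] [NormedSpace ℝ E]
  {H : Type*} [TopologicalSpace H] {I : ModelWithCorners ℝ E H}
  {M : Type*} [TopologicalSpace M] [ChartedSpace H M] [IsManifold I ∞ M]
  {g : BilinField I M}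

/-- `L` acts on the components of horizontal and vertical parts by the field of endomorphisms
`K`. -/
def ActsByOn (g : BilinField I M) (L : EndoField I.tangent (TangentBundle I M)) (p₀ : M)
    (K : E → E × E →L[ℝ] E × E) : Prop :=
  ∀ u : TangentBundle I M, u.proj ∈ (chartAt H p₀).source → ∀ A : TangentSpace I.tangent u,
    hvAt g p₀ u (L u A) = K (extChartAt I p₀ u.proj) (hvAt g p₀ u A)

variable [FiniteDimensional ℝ E] [I.Boundaryless] {u₀ u : TangentBundle I M}
  {L : EndoField I.tangent (TangentBundle I M)} {K : E → E × E →L[ℝ] E × E}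

theorem hvRep_endo_eventuallyEq (hg : IsMetric g) (hL : ActsByOn g L u₀.proj K)
    (hu : u.proj ∈ (chartAt H u₀.proj).source) (W : VField I.tangent (TangentBundle I M)) :
    hvRep hg u₀ (fun v => L v (W v)) =ᶠ[𝓝 (extChartAt I.tangent u₀ u)]
      fun z => K z.1 (hvRep hg u₀ W z) := by
  filter_upwards [extChartAt_target_mem_nhds_of_source (mem_chart_source_tangent hu)] with z hz
  have hv := (TangentBundle.mem_chart_source_iff _ u₀).1 (mem_chart_source_of_target hz)
  have hz' := (extChartAt I.tangent u₀).right_inv hz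
  have hz1 := congrArg Prod.fst (extChartAt_tangent_apply u₀ _ hv)
  have h1 := hvRep_extChartAt hg hv W
  have h2 := hvRep_extChartAt hg hv (fun v => L v (W v))
  rw [hz'] at hz1 h1 h2
  rw [h1, h2, hL _ hv, hz1]

theorem hvDeriv_endo (hg : IsMetric g) (hL : ActsByOn g L u₀.proj K)
    (hu : u.proj ∈ (chartAt H u₀.proj).source)
    (hK : DifferentiableAt ℝ K (extChartAt I u₀.proj u.proj))
    {W : VField I.tangent (TangentBundle I M)} (hW : SmoothFieldAt W u)
    (A : TangentSpace I.tangent u) :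
    hvDeriv (christoffelRep hg u₀.proj) (hvRep hg u₀ fun v => L v (W v))
        (extChartAt I.tangent u₀ u) (toModel I.tangent u₀ u A) =
      K (extChartAt I u₀.proj u.proj) (hvDeriv (christoffelRep hg u₀.proj) (hvRep hg u₀ W)
          (extChartAt I.tangent u₀ u) (toModel I.tangent u₀ u A))
        + hvNabla (christoffelRep hg u₀.proj) K (extChartAt I u₀.proj u.proj)
          (hvAt g u₀.proj u A).1 (hvAt g u₀.proj u (W u)) := by
  have hz1 := congrArg Prod.fst (extChartAt_tangent_apply u₀ _ hu)
  rw [hvDeriv_congr (hvRep_endo_eventuallyEq hg hL hu W), hvDeriv_clm_apply (by rwa [hz1])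
    (hW.differentiableAt_hvRep hg hu), hz1, hvRep_extChartAt hg hu, toModel_eq_hvUnshear hg hu]
  rfl

/-- At flat points, the structural tensor of the Sasaki metric vanishes for covariantly constant
structures. -/
theorem structuralTensor_sasaki_eq_zero (hg : IsMetric g)
    (hL : IsAlmostComplex L) (hLK : ActsByOn g L u₀.proj K)
    (hu : u.proj ∈ (chartAt H u₀.proj).source)
    (hflat : ∀ a b c,
      modelCurvature (christoffelRep hg u₀.proj) (extChartAt I u₀.proj u.proj) a b c = 0)
    (hK : DifferentiableAt ℝ K (extChartAt I u₀.proj u.proj))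
    (hpar : ∀ ξ c, hvNabla (christoffelRep hg u₀.proj) K (extChartAt I u₀.proj u.proj) ξ c = 0)
    {X Y Z : VField I.tangent (TangentBundle I M)} (hY : SmoothFieldAt Y u) :
    structuralTensor (sasaki g) L X Y Z u = 0 := by
  have h : leviCivita (sasaki g) (fun v => L v (Y v)) u (X u) =
      L u (leviCivita (sasaki g) Y u (X u)) := by
    apply hvAt_injective hg hu
    rw [hvAt_leviCivita_sasaki hg hu hflat (hL.smooth Y u hY), hLK u hu,
      hvAt_leviCivita_sasaki hg hu hflat hY, hvDeriv_endo hg hLK hu hK hY, hpar, add_zero]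
  rw [structuralTensor, h, sub_self, (isMetric_sasaki hg).zero_left]

/-- The Nijenhuis tensor of a structure on `TM` in terms of horizontal and vertical parts. -/
theorem IsComplex.hv_nijenhuis_eq_zero (hg : IsMetric g)
    (hL : IsComplex L) (hLK : ActsByOn g L u₀.proj K)
    (hu : u.proj ∈ (chartAt H u₀.proj).source)
    (hK : DifferentiableAt ℝ K (extChartAt I u₀.proj u.proj)) (c c' : E × E) :
    letI Γ := christoffelRep hg u₀.proj
    letI x := extChartAt I u₀.proj u.proj
    letI y := toModel I u₀.proj u.proj u.2
    K x (hvNabla Γ K x c.1 c') - K x (hvNabla Γ K x c'.1 c)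
      - hvNabla Γ K x (K x c).1 c' + hvNabla Γ K x (K x c').1 c
      - (0, modelCurvature Γ x c.1 c'.1 y) - K x (0, modelCurvature Γ x c.1 (K x c').1 y)
      - K x (0, modelCurvature Γ x (K x c).1 c'.1 y)
      + (0, modelCurvature Γ x (K x c).1 (K x c').1 y) = 0 := by
  have hz := extChartAt_tangent_apply u₀ u hu
  have hz1 := congrArg Prod.fst hz
  -- The Nijenhuis condition is tested on fields whose two parts have constant components; their
  -- covariant derivatives are pure Christoffel terms, which cancel at the end because `K` squares
  -- to `-1`.
  have hW : ∀ c : E × E, SmoothFieldAt (hvField hg u₀ fun _ => c) u := fun c =>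
    smoothFieldAt_hvField hg contDiffAt_const hu
  have hWr : ∀ c : E × E, hvRep hg u₀ (hvField hg u₀ fun _ => c)
      =ᶠ[𝓝 (extChartAt I.tangent u₀ u)] fun _ => c := fun c => by
    filter_upwards [extChartAt_target_mem_nhds_of_source (mem_chart_source_tangent hu)] with z hz
    exact hvRep_hvField hg hz _
  have hWu : ∀ c : E × E, hvAt g u₀.proj u (hvField hg u₀ (fun _ => c) u) = c := fun c => by
    rw [← hvRep_extChartAt hg hu]
    exact (hWr c).self_of_nhds
  have hLW := fun c => hL.almostComplex.smooth _ u (hW c)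
  have hD : ∀ (c : E × E) (A : TangentSpace I.tangent u),
      hvDeriv (christoffelRep hg u₀.proj) (hvRep hg u₀ (hvField hg u₀ fun _ => c))
        (extChartAt I.tangent u₀ u) (toModel I.tangent u₀ u A) =
      (christoffelRep hg u₀.proj (extChartAt I u₀.proj u.proj) (hvAt g u₀.proj u A).1 c.1,
        christoffelRep hg u₀.proj (extChartAt I u₀.proj u.proj) (hvAt g u₀.proj u A).1 c.2) := by
    intro c A
    rw [hvDeriv_congr (hWr c), hvDeriv_const, hz1, toModel_eq_hvUnshear hg hu]
    rfl
  have hKK : ∀ c, K (extChartAt I u₀.proj u.proj) (K (extChartAt I u₀.proj u.proj) c) = -c := by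
    intro c
    have h := congrArg (hvAt g u₀.proj u)
      (hL.almostComplex.sq u (hvField hg u₀ (fun _ => c) u))
    rwa [hLK u hu, hLK u hu, ← neg_one_smul ℝ (hvField _ _ _ _), hvAt_smul hg, neg_one_smul,
      hWu] at h
  have hN := congrArg (hvAt g u₀.proj u) (hL.nijenhuis_eq_zero _ _ u (hW c) (hW c'))
  rw [nijenhuis, hvAt_sub hg, hvAt_add hg, hvAt_add hg, hLK u hu, hLK u hu,
    hvAt_mlieBracket hg (hW c) (hW c') hu, hvAt_mlieBracket hg (hW c) (hLW c') hu,
    hvAt_mlieBracket hg (hLW c) (hW c') hu, hvAt_mlieBracket hg (hLW c) (hLW c') hu,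
    hvDeriv_endo hg hLK hu hK (hW c), hvDeriv_endo hg hLK hu hK (hW c'),
    hvDeriv_endo hg hLK hu hK (hW c), hvDeriv_endo hg hLK hu hK (hW c')] at hN
  simp only [hD, hLK u hu, hWu] at hN
  have h0 : hvAt g u₀.proj u (0 : TangentSpace I.tangent u) = 0 := by
    rw [← sub_self (0 : TangentSpace I.tangent u), hvAt_sub hg, sub_self]
  rw [h0] at hN
  rw [← hN]
  simp only [map_sub, map_add, hKK]
  abel

end HVEndo

/-! ### Linear algebra: two vanishing criteria for a self-adjoint complex structure -/

section NordenAlgebra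

variable {E : Type*} [NormedAddCommGroup E] [NormedSpace ℝ E]
  {G : E →L[ℝ] E →L[ℝ] ℝ} {J : E →L[ℝ] E}

/-- A field of self-adjoint endomorphisms `S a` that anticommute with `J` vanishes if
`S (J a) = -J ∘ S a`. -/
theorem eq_zero_of_selfAdjoint_of_anticomm (hsymm : ∀ v w, G v w = G w v)
    (hG : ∀ v, (∀ w, G v w = 0) → v = 0) (hJG : ∀ v w, G (J v) w = G v (J w))
    (hJ : ∀ v, J (J v) = -v) {S : E → E → E}
    (hSG : ∀ a b c, G (S a b) c = G b (S a c))
    (hSJ : ∀ a b, S a (J b) = -J (S a b)) (hSJ' : ∀ a b, S (J a) b = -J (S a b)) (a b : E) :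
    S a b = 0 := by
  have h3 : ∀ a b c, G (S (J a) b) c = -G (S a b) (J c) := fun a b c => by
    rw [hSJ', map_neg, neg_apply, hJG]
  have h2 : ∀ a b c, G (S a (J b)) c = -G (S a b) (J c) := fun a b c => by
    rw [hSJ, map_neg, neg_apply, hJG]
  have hp : ∀ a b c, G (S a b) c = G (S a c) b := fun a b c => by
    rw [hSG, hsymm]
  -- `S (J a)` is self-adjoint, whereas `-J ∘ S a` is skew-adjoint, because `J` and `S a` are
  -- self-adjoint and anticommute.
  have h0 : ∀ c, G (S a b) (J c) = 0 := fun c => by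
    have e1 := h3 a b c
    have e2 := h2 a b c
    have e3 := h3 a c b
    rw [hp (J a) c b, hp a c (J b)] at e3
    linarith
  refine hG _ fun w => ?_
  have := h0 (-J w)
  rwa [map_neg, hJ, neg_neg] at this

/-- An algebraic curvature tensor that commutes with `J` is pure; hence it vanishes if its
`J`-averaged part vanishes. -/
theorem curvature_eq_zero_of_pure (hsymm : ∀ v w, G v w = G w v)
    (hG : ∀ v, (∀ w, G v w = 0) → v = 0) (hJG : ∀ v w, G (J v) w = G v (J w))
    (hJ : ∀ v, J (J v) = -v) {R : E → E → E → E} (hR : ∀ a b c, R a b c = -R b a c)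
    (hRG : ∀ a b c d, G (R a b c) d = -G c (R a b d))
    (hB : ∀ a b c, R a b c + R b c a + R c a b = 0)
    (hRJ : ∀ a b c, R a b (J c) = J (R a b c))
    (hN : ∀ a b c, -R a b c + J (R a (J b) c) + J (R (J a) b c) + R (J a) (J b) c = 0)
    (a b c : E) : R a b c = 0 := by
  have hskew : ∀ a b c d, G (R a b c) d = -G (R b a c) d := fun a b c d => by
    rw [hR, map_neg, neg_apply]
  have hskew' : ∀ a b c d, G (R a b c) d = -G (R a b d) c := fun a b c d => by
    rw [hRG, hsymm]
  have hB' : ∀ a b c d, G (R a b c) d + G (R b c a) d + G (R c a b) d = 0 := fun a b c d => by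
    rw [← add_apply, ← add_apply, ← map_add, ← map_add, hB, map_zero, zero_apply]
  -- Pair symmetry, from the four Bianchi identities on `a, b, c, d` and skewness in each pair.
  have hpair : ∀ a b c d, G (R a b c) d = G (R c d a) b := fun a b c d => by
    linarith [hB' a b c d, hB' b c d a, hB' c d a b, hB' d a b c, hskew a b c d, hskew b c a d,
      hskew c a b d, hskew b d c a, hskew c d b a, hskew d b c a, hskew' b c d a, hskew' c d b a,
      hskew' d b c a, hskew' c d a b, hskew' d a c b, hskew' a c d b, hskew d a c b,
      hskew a c d b, hskew' d a b c, hskew' a b d c, hskew' b d a c, hskew b d a c,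
      hskew' a b c d, hskew' b c a d, hskew' c a b d, hskew c a d b]
  -- Pair symmetry carries the commutation of `J` with `R c d` over to the first pair of arguments.
  have hswap : ∀ a b c d, G (R (J a) b c) d = G (R a (J b) c) d := fun a b c d => by
    rw [hpair, hRJ, hJG, ← hpair]
  -- Bianchi with `J` inserted on one of the three vectors in turn, and Bianchi composed with `J`:
  -- modulo `hswap` these four relations force the two positions of `J` to agree.
  have hpure : ∀ a b c d, G (R (J a) b c) d = G (R a b (J c)) d := fun a b c d => by
    have s1 := hB' (J a) b c d
    have s2 := hB' a (J b) c d
    have s3 := hB' a b (J c) d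
    have hJB : G (R a b (J c)) d + G (R b c (J a)) d + G (R c a (J b)) d = 0 := by
      rw [hRJ, hRJ, hRJ, hJG, hJG, hJG]
      exact hB' a b c (J d)
    linarith [hswap a b c d, hswap b c a d, hswap c a b d]
  have h1 : ∀ a b c, R (J a) b c = J (R a b c) := fun a b c => by
    refine sub_eq_zero.1 (hG _ fun d => ?_)
    rw [map_sub, sub_apply, hpure, hRJ, sub_self]
  have h2 : ∀ a b c, R a (J b) c = J (R a b c) := fun a b c => by
    rw [hR, h1, hR b a, map_neg, neg_neg]
  have h := hN a b c
  rw [h1, h1, h2, hJ] at h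
  -- By purity, each of the four terms of `hN` equals `-R a b c`.
  have h4 : (-4 : ℝ) • R a b c = 0 := by
    rw [← h]; module
  exact (smul_eq_zero.1 h4).resolve_left (by norm_num)

end NordenAlgebra

/-! ### Derivatives of the structure and curvature identities -/

section NordenCalculus

variable {E : Type*} [NormedAddCommGroup E] [NormedSpace ℝ E]
  {Γ : E → E →L[ℝ] E →L[ℝ] E} {G : E → E →L[ℝ] E →L[ℝ] ℝ} {J : E → E →L[ℝ] E} {x : E}

/-- Covariant derivative of the identity `J² = -1`. -/
theorem modelNabla_anticomm (hJd : DifferentiableAt ℝ J x)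
    (hJ : ∀ᶠ z in 𝓝 x, ∀ v, J z (J z v) = -v) (a b : E) :
    modelNabla Γ J x a (J x b) = -J x (modelNabla Γ J x a b) := by
  have h1 : fderiv ℝ (fun z => J z (J z b)) x a = 0 := by
    have : (fun z => J z (J z b)) =ᶠ[𝓝 x] fun _ => -b := by
      filter_upwards [hJ] with z hz
      exact hz b
    rw [this.fderiv_eq]
    simp
  have hJb : DifferentiableAt ℝ (fun z => J z b) x := hJd.clm_apply (differentiableAt_const b)
  have h2 : fderiv ℝ (fun z => J z b) x a = fderiv ℝ J x a b := by
    rw [fderiv_clm_apply hJd (differentiableAt_const b)]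
    simp
  rw [fderiv_clm_apply hJd hJb] at h1
  simp only [add_apply, ContinuousLinearMap.comp_apply, ContinuousLinearMap.flip_apply, h2] at h1
  have hx := hJ.self_of_nhds
  rw [modelNabla, modelNabla, hx, map_sub, map_add, hx, map_neg, ← sub_eq_zero]
  rw [← h1]
  abel

/-- Covariant derivative of the self-adjointness of `J`, with `G` parallel. -/
theorem modelNabla_selfAdjoint (hGd : DifferentiableAt ℝ G x) (hJd : DifferentiableAt ℝ J x)
    (hmet : ∀ a b c, fderiv ℝ G x a b c = G x (Γ x a b) c + G x b (Γ x a c))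
    (hJG : ∀ᶠ z in 𝓝 x, ∀ v w, G z (J z v) w = G z v (J z w)) (a b c : E) :
    G x (modelNabla Γ J x a b) c = G x b (modelNabla Γ J x a c) := by
  have hJb : ∀ b, DifferentiableAt ℝ (fun z => J z b) x := fun b =>
    hJd.clm_apply (differentiableAt_const b)
  have h2 : ∀ b, fderiv ℝ (fun z => J z b) x a = fderiv ℝ J x a b := fun b => by
    rw [fderiv_clm_apply hJd (differentiableAt_const b)]
    simp
  have h : (fun z => G z (J z b) c) =ᶠ[𝓝 x] fun z => G z b (J z c) := by
    filter_upwards [hJG] with z hz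
    exact hz b c
  have h1 : fderiv ℝ (fun z => G z (J z b) c) x a = fderiv ℝ (fun z => G z b (J z c)) x a := by
    rw [h.fderiv_eq]
  rw [fderiv_clm_apply (hGd.clm_apply (hJb b)) (differentiableAt_const c),
    fderiv_clm_apply hGd (hJb b),
    fderiv_clm_apply (hGd.clm_apply (differentiableAt_const b)) (hJb c),
    fderiv_clm_apply hGd (differentiableAt_const b)] at h1
  simp only [add_apply, ContinuousLinearMap.comp_apply, ContinuousLinearMap.flip_apply, h2,
    hmet, fderiv_fun_const, Pi.zero_apply, zero_apply, map_zero, zero_add] at h1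
  have hx := hJG.self_of_nhds
  simp only [modelNabla, map_add, map_sub, add_apply, sub_apply]
  rw [hx] at h1 ⊢
  linarith

theorem modelCurvature_swap (a b c : E) :
    modelCurvature Γ x a b c = -modelCurvature Γ x b a c := by
  rw [modelCurvature, modelCurvature]
  abel

/-- Symmetry of `Γ` near `x` passes to its derivative, after which the terms of the cyclic sum
cancel. -/
theorem modelCurvature_bianchi (hΓd : DifferentiableAt ℝ Γ x)
    (hΓ : ∀ᶠ z in 𝓝 x, ∀ v w, Γ z v w = Γ z w v) (a b c : E) :
    modelCurvature Γ x a b c + modelCurvature Γ x b c a + modelCurvature Γ x c a b = 0 := by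
  have hd : ∀ a b c, fderiv ℝ Γ x a b c = fderiv ℝ Γ x a c b := fun a b c => by
    rw [← fderiv_apply_apply hΓd, ← fderiv_apply_apply hΓd]
    have : (fun z => Γ z b c) =ᶠ[𝓝 x] fun z => Γ z c b := by
      filter_upwards [hΓ] with z hz
      exact hz b c
    rw [this.fderiv_eq]
  have hx := hΓ.self_of_nhds
  simp only [modelCurvature]
  rw [hd a b c, hd b c a, hd c a b, hx b c, hx c a, hx a b]
  abel

/-- Symmetry of second derivatives, in terms of directional derivatives. -/
theorem fderiv_dirDeriv_symm {F : Type*} [NormedAddCommGroup F] [NormedSpace ℝ F] {f : E → F}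
    (hf : ContDiffAt ℝ 2 f x) {h : E → E → F}
    (hh : ∀ᶠ z in 𝓝 x, ∀ ξ, fderiv ℝ f z ξ = h ξ z) (ξ η : E) :
    fderiv ℝ (h ξ) x η = fderiv ℝ (h η) x ξ := by
  have hd : DifferentiableAt ℝ (fderiv ℝ f) x :=
    (hf.fderiv_right (m := 1) (by norm_num)).differentiableAt (by norm_num)
  have e : ∀ ξ η, fderiv ℝ (h ξ) x η = fderiv ℝ (fderiv ℝ f) x η ξ := fun ξ η => by
    have : h ξ =ᶠ[𝓝 x] fun z => fderiv ℝ f z ξ := by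
      filter_upwards [hh] with z hz
      exact (hz ξ).symm
    rw [this.fderiv_eq, fderiv_clm_apply hd (differentiableAt_const ξ)]
    simp
  rw [e, e]
  exact (hf.isSymmSndFDerivAt (by simp)).eq η ξ

/-- Differentiating the compatibility equation once more and antisymmetrizing gives zero on the
left, as second derivatives of `G` commute, and the curvature terms on the right. -/
theorem modelCurvature_skew (hΓd : DifferentiableAt ℝ Γ x) (hG : ContDiffAt ℝ 2 G x)
    (hmet : ∀ᶠ z in 𝓝 x, ∀ a b c, fderiv ℝ G z a b c = G z (Γ z a b) c + G z b (Γ z a c))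
    (a b c d : E) :
    G x (modelCurvature Γ x a b c) d = -G x c (modelCurvature Γ x a b d) := by
  have hGd := hG.differentiableAt (by norm_num)
  have hGd' : ∀ᶠ z in 𝓝 x, DifferentiableAt ℝ G z := by
    filter_upwards [hG.eventually (by simp)] with z hz
    exact hz.differentiableAt (by norm_num)
  have hΓa : ∀ a b, DifferentiableAt ℝ (fun z => Γ z a b) x := fun a b =>
    (hΓd.clm_apply (differentiableAt_const a)).clm_apply (differentiableAt_const b)
  have h := fderiv_dirDeriv_symm (f := fun z => G z c d)
    (h := fun ξ z => G z (Γ z ξ c) d + G z c (Γ z ξ d))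
    ((hG.clm_apply contDiffAt_const).clm_apply contDiffAt_const) (by
      filter_upwards [hmet, hGd'] with z hz hz' ξ
      rw [fderiv_apply_apply hz', hz]) b a
  have e : ∀ ξ η, fderiv ℝ (fun z => G z (Γ z ξ c) d + G z c (Γ z ξ d)) x η =
      (G x (Γ x η (Γ x ξ c)) d + G x (Γ x ξ c) (Γ x η d)) + G x (fderiv ℝ Γ x η ξ c) d
        + ((G x (Γ x η c) (Γ x ξ d) + G x c (Γ x η (Γ x ξ d))) + G x c (fderiv ℝ Γ x η ξ d)) := by
    intro ξ η
    have h1 := (hGd.clm_apply (hΓa ξ c)).clm_apply (differentiableAt_const d)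
    have h2 := (hGd.clm_apply (differentiableAt_const c)).clm_apply (hΓa ξ d)
    rw [fderiv_fun_add h1 h2,
      fderiv_clm_apply (hGd.clm_apply (hΓa ξ c)) (differentiableAt_const d),
      fderiv_clm_apply hGd (hΓa ξ c),
      fderiv_clm_apply (hGd.clm_apply (differentiableAt_const c)) (hΓa ξ d),
      fderiv_clm_apply hGd (differentiableAt_const c)]
    simp only [add_apply, ContinuousLinearMap.comp_apply, ContinuousLinearMap.flip_apply,
      fderiv_apply_apply hΓd, hmet.self_of_nhds, fderiv_fun_const, Pi.zero_apply, zero_apply,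
      map_zero, zero_add]
    ring
  rw [e, e] at h
  simp only [modelCurvature, map_add, map_sub, add_apply, sub_apply]
  linarith

/-- The integrability condition of `∇J = 0`, again from the symmetry of second derivatives; `J` has
to be parallel near `x` and not only at `x`, since the equation is differentiated. -/
theorem modelCurvature_comm (hΓd : DifferentiableAt ℝ Γ x) (hJ : ContDiffAt ℝ 2 J x)
    (hpar : ∀ᶠ z in 𝓝 x, ∀ a b, modelNabla Γ J z a b = 0) (a b c : E) :
    modelCurvature Γ x a b (J x c) = J x (modelCurvature Γ x a b c) := by
  have hJd := hJ.differentiableAt (by norm_num)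
  have hJd' : ∀ᶠ z in 𝓝 x, DifferentiableAt ℝ J z := by
    filter_upwards [hJ.eventually (by simp)] with z hz
    exact hz.differentiableAt (by norm_num)
  have hJc : ∀ {z : E}, DifferentiableAt ℝ J z → ∀ c η,
      fderiv ℝ (fun z => J z c) z η = fderiv ℝ J z η c := fun {z} hz c η => by
    rw [fderiv_clm_apply hz (differentiableAt_const c)]
    simp
  have hpar' : ∀ᶠ z in 𝓝 x, ∀ a b, fderiv ℝ J z a b = J z (Γ z a b) - Γ z a (J z b) := by
    filter_upwards [hpar] with z hz a b
    have := hz a b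
    rw [modelNabla, sub_eq_zero] at this
    rw [← this, add_sub_cancel_right]
  have hΓa : ∀ a, DifferentiableAt ℝ (fun z => Γ z a) x := fun a =>
    hΓd.clm_apply (differentiableAt_const a)
  have hΓab : ∀ a b, DifferentiableAt ℝ (fun z => Γ z a b) x := fun a b =>
    (hΓa a).clm_apply (differentiableAt_const b)
  have hJcd := hJd.clm_apply (differentiableAt_const c)
  have h := fderiv_dirDeriv_symm (f := fun z => J z c)
    (h := fun ξ z => J z (Γ z ξ c) - Γ z ξ (J z c))
    (hJ.clm_apply contDiffAt_const) (by
      filter_upwards [hpar', hJd'] with z hz hz' ξ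
      rw [hJc hz', hz]) b a
  have e : ∀ ξ η, fderiv ℝ (fun z => J z (Γ z ξ c) - Γ z ξ (J z c)) x η =
      (J x (Γ x η (Γ x ξ c)) - Γ x η (J x (Γ x ξ c))) + J x (fderiv ℝ Γ x η ξ c)
        - (fderiv ℝ Γ x η ξ (J x c) + Γ x ξ (J x (Γ x η c) - Γ x η (J x c))) := by
    intro ξ η
    have hΓξ : fderiv ℝ (fun z => Γ z ξ) x η = fderiv ℝ Γ x η ξ := by
      rw [fderiv_clm_apply hΓd (differentiableAt_const ξ)]
      simp
    rw [fderiv_fun_sub (hJd.clm_apply (hΓab ξ c)) ((hΓa ξ).clm_apply hJcd),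
      fderiv_clm_apply hJd (hΓab ξ c), fderiv_clm_apply (hΓa ξ) hJcd]
    simp only [add_apply, sub_apply, ContinuousLinearMap.comp_apply,
      ContinuousLinearMap.flip_apply, fderiv_apply_apply hΓd, hJc hJd, hpar'.self_of_nhds, hΓξ]
    abel
  rw [e, e] at h
  simp only [modelCurvature, map_add, map_sub] at h ⊢
  rw [← sub_eq_zero] at h ⊢
  rw [← neg_eq_zero, ← h]
  abel

end NordenCalculus

/-! ### The three structures on horizontal and vertical parts -/

section ModelLifts

variable {E : Type*} [NormedAddCommGroup E] [NormedSpace ℝ E]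

/-- The action of `J₁` on horizontal and vertical parts. -/
def modelLift₁ (_ : E) : E × E →L[ℝ] E × E :=
  (-ContinuousLinearMap.snd ℝ E E).prod (ContinuousLinearMap.fst ℝ E E)

/-- The action of `J₂` on horizontal and vertical parts. -/
def modelLift₂ (J : E → E →L[ℝ] E) (x : E) : E × E →L[ℝ] E × E :=
  (ContinuousLinearMap.inl ℝ E E).comp ((J x).comp (ContinuousLinearMap.snd ℝ E E))
    + (ContinuousLinearMap.inr ℝ E E).comp ((J x).comp (ContinuousLinearMap.fst ℝ E E))

/-- The action of `J₃` on horizontal and vertical parts. -/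
def modelLift₃ (J : E → E →L[ℝ] E) (x : E) : E × E →L[ℝ] E × E :=
  (ContinuousLinearMap.inr ℝ E E).comp ((J x).comp (ContinuousLinearMap.snd ℝ E E))
    - (ContinuousLinearMap.inl ℝ E E).comp ((J x).comp (ContinuousLinearMap.fst ℝ E E))

variable {Γ : E → E →L[ℝ] E →L[ℝ] E} {J : E → E →L[ℝ] E} {x : E}

theorem modelLift₁_apply (x : E) (c : E × E) : modelLift₁ x c = (-c.2, c.1) := rfl

theorem modelLift₂_apply (x : E) (c : E × E) : modelLift₂ J x c = (J x c.2, J x c.1) := by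
  simp [modelLift₂]

theorem modelLift₃_apply (x : E) (c : E × E) : modelLift₃ J x c = (-J x c.1, J x c.2) := by
  simp [modelLift₃]

theorem differentiableAt_modelLift₁ : DifferentiableAt ℝ (modelLift₁ (E := E)) x :=
  differentiableAt_const _

theorem differentiableAt_modelLift₂ (hJ : DifferentiableAt ℝ J x) :
    DifferentiableAt ℝ (modelLift₂ J) x :=
  ((differentiableAt_const _).clm_comp (hJ.clm_comp (differentiableAt_const _))).add
    ((differentiableAt_const _).clm_comp (hJ.clm_comp (differentiableAt_const _)))

theorem differentiableAt_modelLift₃ (hJ : DifferentiableAt ℝ J x) :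
    DifferentiableAt ℝ (modelLift₃ J) x :=
  ((differentiableAt_const _).clm_comp (hJ.clm_comp (differentiableAt_const _))).sub
    ((differentiableAt_const _).clm_comp (hJ.clm_comp (differentiableAt_const _)))

theorem fderiv_clm_apply_const {F₁ F₂ : Type*} [NormedAddCommGroup F₁] [NormedSpace ℝ F₁]
    [NormedAddCommGroup F₂] [NormedSpace ℝ F₂] {K : E → F₁ →L[ℝ] F₂}
    (hK : DifferentiableAt ℝ K x) (c : F₁) (ξ : E) :
    fderiv ℝ (fun z => K z c) x ξ = fderiv ℝ K x ξ c := by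
  rw [fderiv_clm_apply hK (differentiableAt_const c)]
  simp

/-- `J₁` only exchanges the two parts, up to sign, and the same connection acts on both. -/
theorem hvNabla_modelLift₁ (ξ : E) (c : E × E) : hvNabla Γ modelLift₁ x ξ c = 0 := by
  have h : fderiv ℝ (modelLift₁ (E := E)) x = 0 := fderiv_const_apply _
  rw [hvNabla, h, modelLift₁_apply, modelLift₁_apply]
  simp

theorem hvNabla_modelLift₂ (hJ : DifferentiableAt ℝ J x) (ξ : E) (c : E × E) :
    hvNabla Γ (modelLift₂ J) x ξ c = (modelNabla Γ J x ξ c.2, modelNabla Γ J x ξ c.1) := by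
  have hc := fun a : E => hJ.clm_apply (differentiableAt_const a)
  have h : (fun z => modelLift₂ J z c) = fun z => (J z c.2, J z c.1) :=
    funext fun z => modelLift₂_apply z c
  rw [hvNabla, ← fderiv_clm_apply_const (differentiableAt_modelLift₂ hJ), h,
    ((hc c.2).hasFDerivAt.prodMk (hc c.1).hasFDerivAt).fderiv, modelLift₂_apply, modelLift₂_apply,
    ContinuousLinearMap.prod_apply, fderiv_clm_apply_const hJ, fderiv_clm_apply_const hJ]
  rfl

theorem hvNabla_modelLift₃ (hJ : DifferentiableAt ℝ J x) (ξ : E) (c : E × E) :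
    hvNabla Γ (modelLift₃ J) x ξ c = (-modelNabla Γ J x ξ c.1, modelNabla Γ J x ξ c.2) := by
  have hc := fun a : E => hJ.clm_apply (differentiableAt_const a)
  have h : (fun z => modelLift₃ J z c) = fun z => (-J z c.1, J z c.2) :=
    funext fun z => modelLift₃_apply z c
  have h' : fderiv ℝ (fun z => (-J z c.1, J z c.2)) x = _ :=
    ((hc c.1).hasFDerivAt.neg.prodMk (hc c.2).hasFDerivAt).fderiv
  rw [hvNabla, ← fderiv_clm_apply_const (differentiableAt_modelLift₃ hJ), h, h', modelLift₃_apply,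
    modelLift₃_apply, ContinuousLinearMap.prod_apply, neg_apply, fderiv_clm_apply_const hJ,
    fderiv_clm_apply_const hJ]
  refine Prod.ext ?_ rfl
  simp only [modelNabla, Prod.fst_add, Prod.fst_sub, map_neg]
  abel

theorem modelNabla_zero_left (b : E) : modelNabla Γ J x 0 b = 0 := by
  simp [modelNabla]

theorem modelNabla_zero_right (a : E) : modelNabla Γ J x a 0 = 0 := by
  simp [modelNabla]

theorem modelNabla_neg_left (a b : E) : modelNabla Γ J x (-a) b = -modelNabla Γ J x a b := by
  simp only [modelNabla, map_neg, neg_apply]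
  abel

theorem modelCurvature_zero_left (a b : E) : modelCurvature Γ x 0 a b = 0 := by
  simp [modelCurvature]

theorem modelCurvature_zero_mid (a b : E) : modelCurvature Γ x a 0 b = 0 := by
  simp [modelCurvature]

theorem modelCurvature_neg_left (a b c : E) :
    modelCurvature Γ x (-a) b c = -modelCurvature Γ x a b c := by
  simp only [modelCurvature, map_neg, neg_apply]
  abel

theorem modelCurvature_neg_mid (a b c : E) :
    modelCurvature Γ x a (-b) c = -modelCurvature Γ x a b c := by
  simp only [modelCurvature, map_neg, neg_apply]
  abel

end ModelLifts

/-! ### Integrability of the lifted structures forces flatness and parallelism -/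

section Lifts

variable {E : Type*} [NormedAddCommGroup E] [NormedSpace ℝ E]
  {H : Type*} [TopologicalSpace H] {I : ModelWithCorners ℝ E H}
  {M : Type*} [TopologicalSpace M] [ChartedSpace H M] [IsManifold I ∞ M]
  {g : BilinField I M} {J : EndoField I M} {u : TangentBundle I M}

theorem vPart_hLift (w : TangentSpace I u.proj) : vPart g u (hLift g u w) = 0 :=
  neg_add_cancel (christoffel g u.proj w u.2)

theorem hPart_liftJ₁ (A : TangentSpace I.tangent u) :
    hPart u (liftJ₁ g u A) = -vPart g u A :=
  zero_sub (vPart g u A)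

theorem hPart_liftJ₂ (A : TangentSpace I.tangent u) :
    hPart u (liftJ₂ g J u A) = J u.proj (vPart g u A) :=
  zero_add (J u.proj (vPart g u A))

variable [FiniteDimensional ℝ E]

/-- For an anti-isometry with `J² = -1`, evaluate the metric on `J v` and `J (J w)`. -/
theorem metricRep_selfAdjoint (hM : IsAlmostSkewHermitian g J) {p₀ : M} {z : E}
    (hz : z ∈ (extChartAt I p₀).target) (v w : E) :
    metricRep hM.metric p₀ z (endoRep hM.almostComplex p₀ z v) w =
      metricRep hM.metric p₀ z v (endoRep hM.almostComplex p₀ z w) := by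
  have h := metricRep_endoRep hM.metric hM.almostComplex hM.skewHermitian hz v
    (endoRep hM.almostComplex p₀ z w)
  rw [endoRep_sq hM.almostComplex hz, map_neg, neg_inj] at h
  exact h

variable [I.Boundaryless]

theorem christoffel_zero_left (hg : IsMetric g) {p : M} (η : TangentSpace I p) :
    christoffel g p 0 η = 0 := by
  apply toModel_injective (mem_chart_source H p)
  rw [toModel_christoffel hg (mem_chart_source H p)]
  simp

theorem vPart_vLift (hg : IsMetric g) (w : TangentSpace I u.proj) : vPart g u (vLift u w) = w := by
  change w + christoffel g u.proj 0 u.2 = w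
  rw [christoffel_zero_left hg, add_zero]

theorem vPart_sub (hg : IsMetric g) (A B : TangentSpace I.tangent u) :
    vPart g u (A - B) = vPart g u A - vPart g u B := by
  rw [sub_eq_add_neg, vPart_add hg, ← neg_one_smul ℝ B, vPart_smul hg, neg_one_smul,
    sub_eq_add_neg]

theorem vPart_liftJ₁ (hg : IsMetric g) (A : TangentSpace I.tangent u) :
    vPart g u (liftJ₁ g u A) = hPart u A := by
  rw [liftJ₁, vPart_sub hg, vPart_vLift hg, vPart_hLift, sub_zero]

theorem vPart_liftJ₂ (hg : IsMetric g) (A : TangentSpace I.tangent u) :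
    vPart g u (liftJ₂ g J u A) = J u.proj (hPart u A) := by
  rw [liftJ₂, vPart_add hg, vPart_vLift hg, vPart_hLift, add_zero]

theorem hPart_liftJ₃ (hg : IsMetric g) (A : TangentSpace I.tangent u) :
    hPart u (liftJ₃ g J u A) = -J u.proj (hPart u A) := by
  rw [liftJ₃, hPart_liftJ₁, vPart_liftJ₂ hg]

theorem vPart_liftJ₃ (hg : IsMetric g) (A : TangentSpace I.tangent u) :
    vPart g u (liftJ₃ g J u A) = J u.proj (vPart g u A) := by
  rw [liftJ₃, vPart_liftJ₁ hg, hPart_liftJ₂]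

theorem isHermitian_liftJ₁ (hg : IsMetric g) : IsHermitian (sasaki g) (liftJ₁ g) := by
  intro u A B
  rw [sasaki, sasaki, hPart_liftJ₁, hPart_liftJ₁, vPart_liftJ₁ hg, vPart_liftJ₁ hg, hg.neg_left,
    hg.neg_right, neg_neg, add_comm]

theorem isSkewHermitian_liftJ₂ (hg : IsMetric g) (h : IsSkewHermitian g J) :
    IsSkewHermitian (sasaki g) (liftJ₂ g J) := by
  intro u A B
  rw [sasaki, sasaki, hPart_liftJ₂, hPart_liftJ₂, vPart_liftJ₂ hg, vPart_liftJ₂ hg, h, h]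
  ring

theorem isSkewHermitian_liftJ₃ (hg : IsMetric g) (h : IsSkewHermitian g J) :
    IsSkewHermitian (sasaki g) (liftJ₃ g J) := by
  intro u A B
  rw [sasaki, sasaki, hPart_liftJ₃ hg, hPart_liftJ₃ hg, vPart_liftJ₃ hg, vPart_liftJ₃ hg,
    hg.neg_left, hg.neg_right, h, h]
  ring

theorem actsByOn_liftJ₁ (hg : IsMetric g) (p₀ : M) : ActsByOn g (liftJ₁ g) p₀ modelLift₁ := by
  intro u _ A
  rw [modelLift₁_apply, hvAt, hPart_liftJ₁, vPart_liftJ₁ hg, map_neg]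
  rfl

theorem actsByOn_liftJ₂ (hg : IsMetric g) (hJ : IsAlmostComplex J) (p₀ : M) :
    ActsByOn g (liftJ₂ g J) p₀ (modelLift₂ (endoRep hJ p₀)) := by
  intro u hu A
  rw [modelLift₂_apply, hvAt, hPart_liftJ₂, vPart_liftJ₂ hg, ← endoRep_toModel hJ hu,
    ← endoRep_toModel hJ hu]
  rfl

theorem actsByOn_liftJ₃ (hg : IsMetric g) (hJ : IsAlmostComplex J) (p₀ : M) :
    ActsByOn g (liftJ₃ g J) p₀ (modelLift₃ (endoRep hJ p₀)) := by
  intro u hu A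
  rw [modelLift₃_apply, hvAt, hPart_liftJ₃ hg, vPart_liftJ₃ hg, map_neg, ← endoRep_toModel hJ hu,
    ← endoRep_toModel hJ hu]
  rfl

variable {p₀ p : M}

theorem differentiableAt_endoRep (hJ : IsAlmostComplex J) (hp : p ∈ (chartAt H p₀).source) :
    DifferentiableAt ℝ (endoRep hJ p₀) (extChartAt I p₀ p) :=
  (contDiffAt_endoRep hJ hp).differentiableAt (by simp)

/-- A tensorial consequence of integrability forces `J` to be parallel. -/
theorem modelNabla_endoRep_eq_zero (hM : IsAlmostSkewHermitian g J)
    (hp : p ∈ (chartAt H p₀).source)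
    (h : ∀ a b, modelNabla (christoffelRep hM.metric p₀) (endoRep hM.almostComplex p₀)
        (extChartAt I p₀ p) (endoRep hM.almostComplex p₀ (extChartAt I p₀ p) a) b =
      -endoRep hM.almostComplex p₀ (extChartAt I p₀ p)
        (modelNabla (christoffelRep hM.metric p₀) (endoRep hM.almostComplex p₀)
          (extChartAt I p₀ p) a b)) (a b : E) :
    modelNabla (christoffelRep hM.metric p₀) (endoRep hM.almostComplex p₀)
      (extChartAt I p₀ p) a b = 0 := by
  have hx := extChartAt_mem_target (I := I) hp
  have hJd := differentiableAt_endoRep hM.almostComplex hp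
  have hn := extChartAt_target_mem_nhds_of_source (I := I) hp
  refine eq_zero_of_selfAdjoint_of_anticomm (metricRep_symm hM.metric p₀ _)
    (metricRep_nondegenerate hM.metric hx) (metricRep_selfAdjoint hM hx)
    (endoRep_sq hM.almostComplex hx)
    (S := modelNabla (christoffelRep hM.metric p₀) (endoRep hM.almostComplex p₀)
      (extChartAt I p₀ p)) ?_ ?_ h a b
  · exact modelNabla_selfAdjoint
      ((contDiffAt_metricRep hM.metric hp).differentiableAt (by simp)) hJd
      (fderiv_metricRep hM.metric hx)
      (by filter_upwards [hn] with z hz using metricRep_selfAdjoint hM hz)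
  · exact modelNabla_anticomm hJd
      (by filter_upwards [hn] with z hz using endoRep_sq hM.almostComplex hz)

/-- The consequences of integrability at the tangent vector with components `y`. -/
theorem IsComplex.model_nijenhuis_eq_zero (hg : IsMetric g)
    {L : EndoField I.tangent (TangentBundle I M)} {K : E → E × E →L[ℝ] E × E}
    (hL : IsComplex L) (hLK : ActsByOn g L p₀ K) (hp : p ∈ (chartAt H p₀).source)
    (hK : DifferentiableAt ℝ K (extChartAt I p₀ p)) (c c' : E × E) (y : E) :
    letI Γ := christoffelRep hg p₀
    letI x := extChartAt I p₀ p
    K x (hvNabla Γ K x c.1 c') - K x (hvNabla Γ K x c'.1 c)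
      - hvNabla Γ K x (K x c).1 c' + hvNabla Γ K x (K x c').1 c
      - (0, modelCurvature Γ x c.1 c'.1 y) - K x (0, modelCurvature Γ x c.1 (K x c').1 y)
      - K x (0, modelCurvature Γ x (K x c).1 c'.1 y)
      + (0, modelCurvature Γ x (K x c).1 (K x c').1 y) = 0 := by
  -- Integrability holds at every point of the fibre over `p`, so `y` may be prescribed.
  have h := hL.hv_nijenhuis_eq_zero (u₀ := ⟨p₀, 0⟩) (u := ⟨p, ofModel I p₀ p y⟩) hg hLK hp hK c c'
  rwa [toModel_ofModel hp] at h

/-- `J₁` makes horizontal vectors vertical, so on two of them only the curvature of the first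
bracket survives. -/
theorem curvature_eq_zero_of_isComplex₁ (hg : IsMetric g) (h : IsComplex (liftJ₁ g))
    (hp : p ∈ (chartAt H p₀).source) (a b y : E) :
    modelCurvature (christoffelRep hg p₀) (extChartAt I p₀ p) a b y = 0 := by
  have h1 := congrArg Prod.snd (h.model_nijenhuis_eq_zero hg (actsByOn_liftJ₁ hg p₀) hp
    differentiableAt_modelLift₁ (a, 0) (b, 0) y)
  simpa [hvNabla_modelLift₁, modelLift₁_apply, modelCurvature_zero_left,
    modelCurvature_zero_mid] using h1

/-- As for `J₁`; the terms in `∇J` lie in the horizontal part and do not interfere. -/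
theorem curvature_eq_zero_of_isComplex₂ (hg : IsMetric g) (hJ : IsAlmostComplex J)
    (h : IsComplex (liftJ₂ g J)) (hp : p ∈ (chartAt H p₀).source) (a b y : E) :
    modelCurvature (christoffelRep hg p₀) (extChartAt I p₀ p) a b y = 0 := by
  have hJd := differentiableAt_endoRep hJ hp
  have h1 := congrArg Prod.snd (h.model_nijenhuis_eq_zero hg (actsByOn_liftJ₂ hg hJ p₀) hp
    (differentiableAt_modelLift₂ hJd) (a, 0) (b, 0) y)
  generalize extChartAt I p₀ p = x at hJd h1 ⊢
  simpa [hvNabla_modelLift₂ hJd, modelLift₂_apply, modelCurvature_zero_left,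
    modelCurvature_zero_mid, modelNabla_zero_left, modelNabla_zero_right] using h1

theorem modelNabla_eq_zero_of_isComplex₂ (hM : IsAlmostSkewHermitian g J)
    (h : IsComplex (liftJ₂ g J)) (hp : p ∈ (chartAt H p₀).source) (a b : E) :
    modelNabla (christoffelRep hM.metric p₀) (endoRep hM.almostComplex p₀)
      (extChartAt I p₀ p) a b = 0 := by
  have hx := extChartAt_mem_target (I := I) hp
  have hn := extChartAt_target_mem_nhds_of_source (I := I) hp
  have hJd := differentiableAt_endoRep hM.almostComplex hp
  have hN := h.model_nijenhuis_eq_zero hM.metric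
    (actsByOn_liftJ₂ hM.metric hM.almostComplex p₀) hp (differentiableAt_modelLift₂ hJd)
  have hanti := modelNabla_anticomm (Γ := christoffelRep hM.metric p₀) hJd
    (by filter_upwards [hn] with z hz using endoRep_sq hM.almostComplex hz)
  refine modelNabla_endoRep_eq_zero hM hp (fun a b => ?_) a b
  have hsq := endoRep_sq hM.almostComplex hx
  generalize extChartAt I p₀ p = x at hJd hN hanti hsq ⊢
  have hsymm : ∀ a b, modelNabla (christoffelRep hM.metric p₀) (endoRep hM.almostComplex p₀)
      x a b = modelNabla (christoffelRep hM.metric p₀) (endoRep hM.almostComplex p₀) x b a := by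
    intro a b
    -- A horizontal pair gives `J (S a b - S b a) = 0` with `S = ∇J`; applying `J` once more removes
    -- it.
    have h1 := congrArg Prod.fst (hN (a, 0) (b, 0) 0)
    have h2 := congrArg (endoRep hM.almostComplex p₀ x) h1
    simpa [hvNabla_modelLift₂ hJd, modelLift₂_apply, modelCurvature_zero_left,
      modelCurvature_zero_mid, modelNabla_zero_left, modelNabla_zero_right,
      hsq, neg_add_eq_zero] using h2
  -- A vertical pair gives `S (J a) b = S (J b) a`. Then `S (J a) b = S (J b) a = S a (J b) = -J (S
  -- a b)`.
  have h1 := congrArg Prod.fst (hN (0, a) (0, b) 0)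
  have h2 : modelNabla (christoffelRep hM.metric p₀) (endoRep hM.almostComplex p₀)
      x (endoRep hM.almostComplex p₀ x a) b =
      modelNabla (christoffelRep hM.metric p₀) (endoRep hM.almostComplex p₀)
        x (endoRep hM.almostComplex p₀ x b) a := by
    simpa [hvNabla_modelLift₂ hJd, modelLift₂_apply, modelCurvature_zero_left,
      modelCurvature_zero_mid, modelNabla_zero_left, modelNabla_zero_right,
      neg_add_eq_zero] using h1
  rw [h2, hsymm, hanti]

theorem modelNabla_eq_zero_of_isComplex₃ (hM : IsAlmostSkewHermitian g J)
    (h : IsComplex (liftJ₃ g J)) (hp : p ∈ (chartAt H p₀).source) (a b : E) :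
    modelNabla (christoffelRep hM.metric p₀) (endoRep hM.almostComplex p₀)
      (extChartAt I p₀ p) a b = 0 := by
  have hJd := differentiableAt_endoRep hM.almostComplex hp
  refine modelNabla_endoRep_eq_zero hM hp (fun a b => ?_) a b
  -- A mixed pair has no curvature terms, since `J₃` preserves both parts; what remains is `J (S a
  -- b) + S (J a) b = 0`.
  have h1 := congrArg Prod.snd (h.model_nijenhuis_eq_zero hM.metric
    (actsByOn_liftJ₃ hM.metric hM.almostComplex p₀) hp (differentiableAt_modelLift₃ hJd)
    (a, 0) (0, b) 0)
  generalize extChartAt I p₀ p = x at hJd h1 ⊢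
  rw [eq_neg_iff_add_eq_zero, add_comm]
  simpa [hvNabla_modelLift₃ hJd, modelLift₃_apply, modelCurvature_zero_left,
    modelCurvature_zero_mid, modelNabla_zero_left, modelNabla_zero_right, modelNabla_neg_left]
    using h1

theorem curvature_eq_zero_of_isComplex₃ (hM : IsAlmostSkewHermitian g J)
    (h : IsComplex (liftJ₃ g J)) (hp : p ∈ (chartAt H p₀).source) (a b y : E) :
    modelCurvature (christoffelRep hM.metric p₀) (extChartAt I p₀ p) a b y = 0 := by
  have hx := extChartAt_mem_target (I := I) hp
  have hn := extChartAt_target_mem_nhds_of_source (I := I) hp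
  have hJd := differentiableAt_endoRep hM.almostComplex hp
  have hΓd : DifferentiableAt ℝ (christoffelRep hM.metric p₀) (extChartAt I p₀ p) :=
    ((contDiffOn_christoffelRep hM.metric p₀).contDiffAt hn).differentiableAt (by simp)
  -- Parallelism is needed on a neighbourhood for `modelCurvature_comm`; it holds on the whole chart
  -- domain.
  have hpar : ∀ᶠ z in 𝓝 (extChartAt I p₀ p), ∀ a b, modelNabla (christoffelRep hM.metric p₀)
      (endoRep hM.almostComplex p₀) z a b = 0 := by
    filter_upwards [hn] with z hz a b
    have := modelNabla_eq_zero_of_isComplex₃ hM h (mem_chart_source_of_target hz) a b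
    rwa [(extChartAt I p₀).right_inv hz] at this
  refine curvature_eq_zero_of_pure (metricRep_symm hM.metric p₀ _)
    (metricRep_nondegenerate hM.metric hx) (metricRep_selfAdjoint hM hx)
    (endoRep_sq hM.almostComplex hx) modelCurvature_swap
    (modelCurvature_skew hΓd (contDiffAt_infty.1 (contDiffAt_metricRep hM.metric hp) 2) ?_)
    (modelCurvature_bianchi hΓd ?_)
    (modelCurvature_comm hΓd (contDiffAt_infty.1 (contDiffAt_endoRep hM.almostComplex hp) 2) hpar)
    (fun a b y => ?_) a b y
  · filter_upwards [hn] with z hz using fderiv_metricRep hM.metric hz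
  · filter_upwards [hn] with z hz using christoffelRep_symm hM.metric hz
  -- On a horizontal pair `J₃` is `-J`, so all four curvature terms are present and give the
  -- averaged identity.
  · have h1 := congrArg Prod.snd (h.model_nijenhuis_eq_zero hM.metric
      (actsByOn_liftJ₃ hM.metric hM.almostComplex p₀) hp (differentiableAt_modelLift₃ hJd)
      (a, 0) (b, 0) y)
    have hp0 := fun a b => hpar.self_of_nhds a b
    generalize extChartAt I p₀ p = x at hJd h1 hp0 ⊢
    simpa [hvNabla_modelLift₃ hJd, modelLift₃_apply, modelCurvature_neg_left,
      modelCurvature_neg_mid, hp0] using h1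

theorem structuralTensorVanishes_liftJ₁ (hg : IsMetric g) (h : IsComplex (liftJ₁ g)) :
    StructuralTensorVanishes (sasaki g) (liftJ₁ g) := fun _ _ _ u _ hY _ =>
  structuralTensor_sasaki_eq_zero (u₀ := u) hg h.almostComplex (actsByOn_liftJ₁ hg u.proj)
    (mem_chart_source H u.proj)
    (curvature_eq_zero_of_isComplex₁ hg h (mem_chart_source H u.proj)) differentiableAt_modelLift₁
    hvNabla_modelLift₁ hY

theorem structuralTensorVanishes_liftJ₂ (hM : IsAlmostSkewHermitian g J)
    (h : IsComplex (liftJ₂ g J)) : StructuralTensorVanishes (sasaki g) (liftJ₂ g J) := by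
  intro _ _ _ u _ hY _
  have hu := mem_chart_source H u.proj
  have hJd := differentiableAt_endoRep (I := I) hM.almostComplex hu
  refine structuralTensor_sasaki_eq_zero (u₀ := u) hM.metric h.almostComplex
    (actsByOn_liftJ₂ hM.metric hM.almostComplex u.proj) hu
    (curvature_eq_zero_of_isComplex₂ hM.metric hM.almostComplex h hu)
    (differentiableAt_modelLift₂ hJd) (fun ξ c => ?_) hY
  rw [hvNabla_modelLift₂ hJd, modelNabla_eq_zero_of_isComplex₂ hM h hu,
    modelNabla_eq_zero_of_isComplex₂ hM h hu]
  rfl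

theorem structuralTensorVanishes_liftJ₃ (hM : IsAlmostSkewHermitian g J)
    (h : IsComplex (liftJ₃ g J)) : StructuralTensorVanishes (sasaki g) (liftJ₃ g J) := by
  intro _ _ _ u _ hY _
  have hu := mem_chart_source H u.proj
  have hJd := differentiableAt_endoRep (I := I) hM.almostComplex hu
  refine structuralTensor_sasaki_eq_zero (u₀ := u) hM.metric h.almostComplex
    (actsByOn_liftJ₃ hM.metric hM.almostComplex u.proj) hu
    (curvature_eq_zero_of_isComplex₃ hM h hu)
    (differentiableAt_modelLift₃ hJd) (fun ξ c => ?_) hY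
  rw [hvNabla_modelLift₃ hJd, modelNabla_eq_zero_of_isComplex₃ hM h hu,
    modelNabla_eq_zero_of_isComplex₃ hM h hu, neg_zero]
  rfl

/-- The converse is the general fact that a parallel structure is integrable, applied to the
manifold `TM` with the Sasaki metric. -/
theorem isComplex_liftJ₁_iff (hg : IsMetric g) :
    IsComplex (liftJ₁ g) ↔ IsKahler (sasaki g) (liftJ₁ g) :=
  ⟨fun h => ⟨isMetric_sasaki hg, h.almostComplex, isHermitian_liftJ₁ hg,
    structuralTensorVanishes_liftJ₁ hg h⟩,
  fun h => h.almostComplex.isComplex_of_parallel h.metric h.parallel⟩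

theorem isComplex_liftJ₂_iff (hM : IsAlmostSkewHermitian g J) :
    IsComplex (liftJ₂ g J) ↔ IsSkewKahler (sasaki g) (liftJ₂ g J) :=
  ⟨fun h => ⟨⟨isMetric_sasaki hM.metric, h.almostComplex,
    isSkewHermitian_liftJ₂ hM.metric hM.skewHermitian⟩, structuralTensorVanishes_liftJ₂ hM h⟩,
  fun h => h.almostSkewHermitian.almostComplex.isComplex_of_parallel h.almostSkewHermitian.metric
    h.parallel⟩

theorem isComplex_liftJ₃_iff (hM : IsAlmostSkewHermitian g J) :
    IsComplex (liftJ₃ g J) ↔ IsSkewKahler (sasaki g) (liftJ₃ g J) :=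
  ⟨fun h => ⟨⟨isMetric_sasaki hM.metric, h.almostComplex,
    isSkewHermitian_liftJ₃ hM.metric hM.skewHermitian⟩, structuralTensorVanishes_liftJ₃ hM h⟩,
  fun h => h.almostSkewHermitian.almostComplex.isComplex_of_parallel h.almostSkewHermitian.metric
    h.parallel⟩

theorem isHypercomplex_lift_iff (hM : IsAlmostSkewHermitian g J) :
    IsHypercomplex (liftJ₁ g) (liftJ₂ g J) (liftJ₃ g J) ↔
      IsPseudoHyperKahler (sasaki g) (liftJ₁ g) (liftJ₂ g J) (liftJ₃ g J) :=
  ⟨fun h => ⟨⟨isMetric_sasaki hM.metric, h.almostHypercomplex, isHermitian_liftJ₁ hM.metric,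
      isSkewHermitian_liftJ₂ hM.metric hM.skewHermitian,
      isSkewHermitian_liftJ₃ hM.metric hM.skewHermitian⟩,
    structuralTensorVanishes_liftJ₁ hM.metric h.complex₁,
    structuralTensorVanishes_liftJ₂ hM h.complex₂, structuralTensorVanishes_liftJ₃ hM h.complex₃⟩,
  fun h => ⟨h.almost.almostHypercomplex,
    h.almost.almostHypercomplex.almostComplex₁.isComplex_of_parallel h.almost.metric h.parallel₁,
    h.almost.almostHypercomplex.almostComplex₂.isComplex_of_parallel h.almost.metric h.parallel₂,
    h.almost.almostHypercomplex.almostComplex₃.isComplex_of_parallel h.almost.metric h.parallel₃⟩⟩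

end Lifts

end SasakiTM

end

theorem mainTheorem12 {E : Type*} [NormedAddCommGroup E] [NormedSpace ℝ E] [FiniteDimensional ℝ E]
    {M : Type*} [TopologicalSpace M] [ChartedSpace E M] [IsManifold 𝓘(ℝ, E) ∞ M]
    (g : SasakiTM.BilinField 𝓘(ℝ, E) M) (J : SasakiTM.EndoField 𝓘(ℝ, E) M)
    (hM : SasakiTM.IsAlmostSkewHermitian g J) :
    ((SasakiTM.IsComplex (SasakiTM.liftJ₁ g) ↔
        SasakiTM.IsKahler (SasakiTM.sasaki g) (SasakiTM.liftJ₁ g)) ∧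
      (SasakiTM.IsComplex (SasakiTM.liftJ₂ g J) ↔
        SasakiTM.IsSkewKahler (SasakiTM.sasaki g) (SasakiTM.liftJ₂ g J)) ∧
      (SasakiTM.IsComplex (SasakiTM.liftJ₃ g J) ↔
        SasakiTM.IsSkewKahler (SasakiTM.sasaki g) (SasakiTM.liftJ₃ g J))) ∧
    (SasakiTM.IsHypercomplex (SasakiTM.liftJ₁ g) (SasakiTM.liftJ₂ g J) (SasakiTM.liftJ₃ g J) ↔
      SasakiTM.IsPseudoHyperKahler (SasakiTM.sasaki g)
        (SasakiTM.liftJ₁ g) (SasakiTM.liftJ₂ g J) (SasakiTM.liftJ₃ g J)) := by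
  exact ⟨⟨SasakiTM.isComplex_liftJ₁_iff hM.metric, SasakiTM.isComplex_liftJ₂_iff hM,
    SasakiTM.isComplex_liftJ₃_iff hM⟩, SasakiTM.isHypercomplex_lift_iff hM⟩
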